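/- **Theorem (Jordan automorphisms of octonion division algebras).** Conventions. For an algebra $A$ with $K$-linear involution $x\mapsto\bar x$ and $\beta\in K$, let $(A,\beta)=\{x+e\cdot y\mid x,y\in A\}$ be its double, with multiplication $(x+e\cdot y)(u+e\cdot v)=(xu+\beta\, v\bar y)+e\cdot(\bar x v+uy)$ and involution $\overline{x+e\cdot y}=\bar x-e\cdot y$; the norm is $N(x)=x\bar x$. A quaternion division algebra over a field $K$ is a $K$-algebra isomorphic to $(E,b)$, where $E/K$ is a separable quadratic field extension with its non-trivial Galois automorphism as involution and $b\in K^*\setminus N(E)$. An octonion division algebra over $K$ is a $K$-algebra isomorphic to $(H,c)$, where $H$ is a quaternion division algebra over $K$ and $c\in K^*\setminus N(H)$; the resulting involution of the octonion algebra is its standard involution $\sigma_s\colon x\mapsto\bar x$. Let $\mathbb O$ be an octonion division algebra over $K$, with bilinear form $\langle x,y\rangle=x\bar y+y\bar x$. Let $\mathrm{Aut}(\mathbb O)$ be the group of its (not necessarily $K$-linear) ring automorphisms, and let $\mathrm{Aut}_J(\mathbb O)$ be the group, under composition, of all additive bijections $\gamma\colon\mathbb O\to\mathbb O$ with $\gamma(1)=1$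 and $\gamma(xyx)=\gamma(x)\gamma(y)\gamma(x)$ for all $x,y\in\mathbb O$. For a quaternion subalgebra $\mathbb H$ of $\mathbb O$, i.e. a $K$-subalgebra that is a quaternion division algebra over $K$, and elements $0\ne e\in\mathbb H^\perp$, $0\ne w\in\mathbb H$, we have $\mathbb O=\mathbb H\oplus e\cdot\mathbb H$; let $$\psi_{(\mathbb H,e,w)}\colon\mathbb O\to\mathbb O,\qquad x+e\cdot y\mapsto x+e\cdot(w^{-1}yw)\qquad(x,y\in\mathbb H),$$ let $\Psi$ be the set of all these maps, and let $\Gamma=\{\psi\circ\varphi\mid\psi\in\Psi,\ \varphi\in\mathrm{Aut}(\mathbb O)\}$. Then $\sigma_s$ is a central element of $\mathrm{Aut}_J(\mathbb O)$, the set $\Gamma$ is a subgroup of $\mathrm{Aut}_J(\mathbb O)$, and $$\mathrm{Aut}_J(\mathbb O)=\langle\sigma_s,\Gamma\rangle\cong\langle\sigma_s\rangle\times\Gamma,$$ where the isomorphism is given by multiplication, $\langle\sigma_s\rangle\times\Gamma\to\langle\sigma_s,\Gamma\rangle$, $(a,g)\mapsto ag$. -/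

import Mathlib

/-- A `K`-linear involution (anti-automorphism of order at most two) of a not necessarily
associative unital `K`-algebra `A`. -/
structure Involution (K A : Type*) [CommRing K] [NonAssocRing A] [Module K A]
    extends A →ₗ[K] A where
  map_mul' : ∀ x y : A, toFun (x * y) = toFun y * toFun x
  involutive' : ∀ x : A, toFun (toFun x) = x

namespace Involution

variable {K A : Type*} [CommRing K] [NonAssocRing A] [Module K A]

instance : FunLike (Involution K A) A A where
  coe σ := σ.toLinearMap
  coe_injective σ τ h := by
    cases σ
    cases τ
    congr
    exact DFunLike.coe_injective h

theorem map_add (σ : Involution K A) (x y : A) : σ (x + y) = σ x + σ y :=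
  σ.toLinearMap.map_add x y

theorem map_smul (σ : Involution K A) (k : K) (x : A) : σ (k • x) = k • σ x :=
  σ.toLinearMap.map_smul k x

theorem map_zero (σ : Involution K A) : σ 0 = 0 :=
  σ.toLinearMap.map_zero

theorem map_neg (σ : Involution K A) (x : A) : σ (-x) = -σ x :=
  σ.toLinearMap.map_neg x

theorem map_mul (σ : Involution K A) (x y : A) : σ (x * y) = σ y * σ x :=
  σ.map_mul' x y

theorem involutive (σ : Involution K A) (x : A) : σ (σ x) = x :=
  σ.involutive' x

theorem map_one (σ : Involution K A) : σ 1 = 1 := by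
  have h := σ.map_mul (σ 1) 1
  rw [mul_one, σ.involutive, mul_one] at h
  exact h.symm

/-- `β` is a value of the norm `x ↦ x * σ x`. -/
def IsNormValue (σ : Involution K A) (β : K) : Prop :=
  ∃ x : A, x * σ x = β • (1 : A)

end Involution

/-- The double `(A, β)` of an algebra `A` with involution `σ` (written `x ↦ x̄` below): the pair
`(x, y)` stands for `x + e · y`, that is, for the matrix with rows `(x, β ȳ)` and `(y, x̄)`. -/
def Doubling {K A : Type*} [CommRing K] [NonAssocRing A] [Module K A]
    (_σ : Involution K A) (_β : K) : Type _ :=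
  A × A

namespace Doubling

variable {K A : Type*} [CommRing K] [NonAssocRing A] [Module K A]
  {σ : Involution K A} {β : K}

instance : AddCommGroup (Doubling σ β) := inferInstanceAs (AddCommGroup (A × A))

instance : Module K (Doubling σ β) := inferInstanceAs (Module K (A × A))

/-- The element `x + e · y`. -/
def mk (x y : A) : Doubling σ β := (x, y)

/-- The component `x` of `x + e · y`. -/
def fst (z : Doubling σ β) : A := Prod.fst z

/-- The component `y` of `x + e · y`. -/
def snd (z : Doubling σ β) : A := Prod.snd z

/-- `(x + e · y) (u + e · v) = (x u + β (v ȳ)) + e · (x̄ v + u y)`. -/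
instance : Mul (Doubling σ β) where
  mul z t := mk (z.fst * t.fst + β • (t.snd * σ z.snd)) (σ z.fst * t.snd + t.fst * z.snd)

instance : One (Doubling σ β) where
  one := mk 1 0

@[ext]
theorem ext {z t : Doubling σ β} (h₁ : z.fst = t.fst) (h₂ : z.snd = t.snd) : z = t :=
  Prod.ext h₁ h₂

@[simp] theorem fst_mk (x y : A) : (mk x y : Doubling σ β).fst = x := rfl
@[simp] theorem snd_mk (x y : A) : (mk x y : Doubling σ β).snd = y := rfl
@[simp] theorem fst_zero : (0 : Doubling σ β).fst = 0 := rfl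
@[simp] theorem snd_zero : (0 : Doubling σ β).snd = 0 := rfl
@[simp] theorem fst_one : (1 : Doubling σ β).fst = 1 := rfl
@[simp] theorem snd_one : (1 : Doubling σ β).snd = 0 := rfl
@[simp] theorem fst_add (z t : Doubling σ β) : (z + t).fst = z.fst + t.fst := rfl
@[simp] theorem snd_add (z t : Doubling σ β) : (z + t).snd = z.snd + t.snd := rfl
@[simp] theorem fst_neg (z : Doubling σ β) : (-z).fst = -z.fst := rfl
@[simp] theorem snd_neg (z : Doubling σ β) : (-z).snd = -z.snd := rfl
@[simp] theorem fst_smul (k : K) (z : Doubling σ β) : (k • z).fst = k • z.fst := rfl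
@[simp] theorem snd_smul (k : K) (z : Doubling σ β) : (k • z).snd = k • z.snd := rfl
@[simp] theorem fst_mul (z t : Doubling σ β) :
    (z * t).fst = z.fst * t.fst + β • (t.snd * σ z.snd) := rfl
@[simp] theorem snd_mul (z t : Doubling σ β) :
    (z * t).snd = σ z.fst * t.snd + t.fst * z.snd := rfl

instance : NonAssocRing (Doubling σ β) :=
  { (inferInstance : AddCommGroup (Doubling σ β)) with
    left_distrib := fun z t r => by
      ext <;> simp [mul_add, add_mul] <;> abel
    right_distrib := fun z t r => by
      ext <;> simp [mul_add, add_mul, Involution.map_add] <;> abel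
    zero_mul := fun z => by ext <;> simp [Involution.map_zero]
    mul_zero := fun z => by ext <;> simp
    one_mul := fun z => by ext <;> simp [Involution.map_zero, Involution.map_one]
    mul_one := fun z => by ext <;> simp }

/-- The standard involution `x + e · y ↦ x̄ - e · y` of the double. -/
def conj (σ : Involution K A) (β : K) : Involution K (Doubling σ β) where
  toFun z := mk (σ z.fst) (-z.snd)
  map_add' z t := by
    ext
    · simp [Involution.map_add]
    · simp [add_comm]
  map_smul' k z := by ext <;> simp [Involution.map_smul]
  map_mul' z t := by
    ext
    · simp [Involution.map_add, Involution.map_mul, Involution.map_smul, Involution.map_neg,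
        Involution.involutive]
    · simp [Involution.involutive, add_comm]
  involutive' z := by ext <;> simp [Involution.involutive]

end Doubling

universe u v

/-- The data from which a quaternion division algebra `(E/K, b)` over `K` is built: a separable
quadratic extension `E/K`, the non-trivial element `σ` of its Galois group, and an element `b` of
`K` which is non-zero and not a norm from `E`. -/
structure QuaternionData (K : Type u) [Field K] : Type (max u (v + 1)) where
  E : Type v
  [field : Field E]
  [algebra : Algebra K E]
  separable : Algebra.IsSeparable K E
  finrank_eq : Module.finrank K E = 2
  σ : Involution K E
  σ_nontrivial : ∃ x : E, σ x ≠ x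
  b : K
  b_ne_zero : b ≠ 0
  b_not_norm : ¬ σ.IsNormValue b

attribute [instance] QuaternionData.field QuaternionData.algebra

namespace QuaternionData

variable {K : Type u} [Field K]

/-- The quaternion division algebra `(E/K, b)`. -/
abbrev Alg (D : QuaternionData.{u, v} K) : Type v := Doubling D.σ D.b

/-- The standard involution of `(E/K, b)`. -/
abbrev conj (D : QuaternionData.{u, v} K) : Involution K D.Alg := Doubling.conj D.σ D.b

end QuaternionData

/-- `A` is a quaternion division algebra over `K`: it is isomorphic, as a `K`-algebra, to some
`(E/K, b)`. -/
def IsQuaternionDivisionAlgebra (K : Type u) (A : Type v) [Field K] [NonUnitalNonAssocRing A]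
    [Module K A] : Prop :=
  ∃ (D : QuaternionData.{u, v} K) (f : A ≃ₗ[K] D.Alg), ∀ x y : A, f (x * y) = f x * f y

/-- An octonion division algebra over `K`: an algebra `O` together with an isomorphism of
`K`-algebras onto `(H, c)`, where `H` is a quaternion division algebra over `K` and the element
`c` of `K` is non-zero and not a norm from `H`. -/
structure OctonionDivisionAlgebra (K : Type u) (O : Type v) [Field K] [NonAssocRing O]
    [Module K O] : Type (max u (v + 1)) where
  H : QuaternionData.{u, v} K
  c : K
  c_ne_zero : c ≠ 0
  c_not_norm : ¬ H.conj.IsNormValue c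
  equiv : O ≃ₗ[K] Doubling H.conj c
  map_mul : ∀ x y : O, equiv (x * y) = equiv x * equiv y

namespace OctonionDivisionAlgebra

variable {K : Type u} {O : Type v} [Field K] [NonAssocRing O] [Module K O]

/-- The standard involution `σ_s` of `O`. -/
def conj (P : OctonionDivisionAlgebra K O) (x : O) : O :=
  P.equiv.symm (Doubling.conj P.H.conj P.c (P.equiv x))

/-- The bilinear form `⟨x, y⟩ = x ȳ + y x̄` associated with the norm `N(x) = x x̄`; its values lie
in `K · 1`. -/
def bilin (P : OctonionDivisionAlgebra K O) (x y : O) : O :=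
  x * P.conj y + y * P.conj x

/-- `ψ` is the map `ψ_(H, e, w) : x + e · y ↦ x + e · (w⁻¹ y w)`, for `x, y ∈ H`, where `H` is a
quaternion subalgebra, `e` is a non-zero element of the orthogonal complement of `H` and `w` is a
non-zero element of `H`, with inverse `w'`. As `O = H ⊕ e · H`, the formula determines `ψ`. -/
structure IsPsi (P : OctonionDivisionAlgebra K O) (H : NonUnitalSubalgebra K O) (e w : O)
    (ψ : O → O) : Prop where
  one_mem : (1 : O) ∈ H
  quaternion : IsQuaternionDivisionAlgebra K H
  e_ne_zero : e ≠ 0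
  e_orthogonal : ∀ x ∈ H, P.bilin e x = 0
  w_mem : w ∈ H
  w_ne_zero : w ≠ 0
  apply_eq : ∃ w' ∈ H, w * w' = 1 ∧ w' * w = 1 ∧
    ∀ x ∈ H, ∀ y ∈ H, ψ (x + e * y) = x + e * ((w' * y) * w)

/-- The set `Ψ` of all maps `ψ_(H, e, w)`. -/
def Psi (P : OctonionDivisionAlgebra K O) : Set (O → O) :=
  {ψ | ∃ (H : NonUnitalSubalgebra K O) (e w : O), P.IsPsi H e w ψ}

/-- The set `Γ` of all maps `ψ ∘ φ` with `ψ ∈ Ψ` and `φ` a ring automorphism of `O`. -/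
def Gamma (P : OctonionDivisionAlgebra K O) : Set (O → O) :=
  {γ | ∃ ψ ∈ P.Psi, ∃ φ : O ≃+* O, γ = ψ ∘ φ}

end OctonionDivisionAlgebra

/-- The group `Aut_J(O)` of Jordan automorphisms: additive bijections `γ` with `γ 1 = 1` and
`γ (x y x) = γ x γ y γ x`. The group law is composition. -/
def jordanAut (O : Type v) [NonAssocRing O] : Subgroup (Equiv.Perm O) where
  carrier := {γ | (∀ x y : O, γ (x + y) = γ x + γ y) ∧ γ 1 = 1 ∧
    ∀ x y : O, γ (x * y * x) = γ x * γ y * γ x}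
  mul_mem' := by
    rintro γ δ ⟨h₀, h₁, h₂⟩ ⟨k₀, k₁, k₂⟩
    refine ⟨fun x y => ?_, ?_, fun x y => ?_⟩
    · simp only [Equiv.Perm.mul_apply, k₀, h₀]
    · rw [Equiv.Perm.mul_apply, k₁, h₁]
    · simp only [Equiv.Perm.mul_apply, k₂, h₂]
  one_mem' := ⟨fun _ _ => rfl, rfl, fun _ _ => rfl⟩
  inv_mem' := by
    rintro γ ⟨h₀, h₁, h₂⟩
    have hi : ∀ z : O, γ (γ⁻¹ z) = z := γ.apply_symm_apply
    refine ⟨fun x y => γ.injective ?_, γ.injective ?_, fun x y => γ.injective ?_⟩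
    · simp only [h₀, hi]
    · rw [hi, h₁]
    · simp only [h₂, hi]

/-!
The norm form of a composition division algebra and its alternativity control Jordan automorphisms.
If `γ` is one, it commutes with `x ↦ x̄`, and trace, norm and polar form are preserved up to a field
automorphism of the centre `K · 1`.

Call `γ` isotopic with respect to `a ≠ 0` if `γ (x y) = (γ x · a⁻¹) (a · γ y)`, that is, if `γ` is
an isomorphism onto an isotope of the algebra; such maps are closed under composition, and those
with `a = 1` are the ring automorphisms. As `a` lies in some quaternion subalgebra, `ψ_(H, e, a⁻¹)`
is isotopic with respect to the same `a`; cancelling it leaves a ring automorphism, so that `Γ` is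
the group of isotopic Jordan automorphisms. The standard involution is not isotopic, as otherwise
`a` would be central and the algebra commutative.

For `v` of trace zero, conjugation by `v` is isotopic and its composite with the standard
involution is the reflection in `v`. Hence reflections lie in the group generated by `σ_s` and `Γ`.
Given a Jordan automorphism `γ` of `H ⊕ e H`, a few of these reflections, which move `γ (a b)` to
`γ a · γ b` and fix what has been corrected before, make it multiplicative on `H`, and then on all
products `e y`; such a map is a ring automorphism.
-/

/-- The alternative laws `x (x y) = x² y` and `(y x) x = y x²`. -/
structure IsAlternative (R : Type*) [NonUnitalNonAssocRing R] : Prop where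
  left : ∀ x y : R, x * (x * y) = x * x * y
  right : ∀ x y : R, y * x * x = y * (x * x)

namespace IsAlternative

variable {R : Type*} [NonUnitalNonAssocRing R] (h : IsAlternative R)
include h

theorem associator_left_self (x y : R) : associator x x y = 0 := by
  rw [associator_apply, h.left, sub_self]

theorem associator_right_self (x y : R) : associator y x x = 0 := by
  rw [associator_apply, h.right, sub_self]

theorem associator_swap_left (x y z : R) : associator y x z = -associator x y z := by
  rw [eq_neg_iff_add_eq_zero]
  calc associator y x z + associator x y z
      = associator (x + y) (x + y) z - associator x x z - associator y y z := by
        simp only [associator_apply, add_mul, mul_add]; abel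
    _ = 0 := by simp only [h.associator_left_self, sub_zero]

theorem associator_swap_right (x y z : R) : associator x z y = -associator x y z := by
  rw [eq_neg_iff_add_eq_zero]
  calc associator x z y + associator x y z
      = associator x (y + z) (y + z) - associator x y y - associator x z z := by
        simp only [associator_apply, add_mul, mul_add]; abel
    _ = 0 := by simp only [h.associator_right_self, sub_zero]

theorem flexible (x y : R) : x * y * x = x * (y * x) := by
  rw [← sub_eq_zero, ← associator_apply, h.associator_swap_right, h.associator_left_self, neg_zero]

theorem left_moufang (x y z : R) : x * (y * (x * z)) = x * y * x * z := by
  have hright : x * y * z + x * z * y = x * (y * z) + x * (z * y) := by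
    have := h.associator_swap_right x y z
    simp only [associator_apply] at this
    rw [← sub_eq_zero, ← sub_eq_zero.2 this]
    abel
  have hsum : associator (x * y) x z + associator x y (x * z) = 0 :=
    calc associator (x * y) x z + associator x y (x * z)
        = -(associator x (x * y) z + associator x (x * z) y) := by
          rw [h.associator_swap_left x (x * y), h.associator_swap_right x (x * z), neg_add]
      _ = -(x * x * y * z + x * x * z * y - x * (x * y * z + x * z * y)) := by
          simp only [associator_apply, h.left, mul_add]; abel
      _ = -(associator (x * x) y z + associator (x * x) z y) := by
          simp only [hright, associator_apply, mul_add, h.left]; abel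
      _ = 0 := by rw [h.associator_swap_right _ y, add_neg_cancel, neg_zero]
  simp only [associator_apply] at hsum
  rw [eq_comm, ← sub_eq_zero, ← hsum]
  abel

theorem associator_mul_self (x y z : R) : associator x (y * x) z = x * associator x y z := by
  rw [h.associator_swap_left y, mul_neg, associator_apply, associator_apply, ← h.flexible,
    ← h.left_moufang, mul_sub]
  abel

theorem middle_moufang (x y z : R) : x * y * (z * x) = x * (y * z) * x := by
  have hassoc : associator x y (z * x) = x * associator y z x := by
    rw [h.associator_swap_right, h.associator_mul_self, h.associator_swap_right x y,
      h.associator_swap_right y x z, h.associator_swap_left x, neg_neg, mul_neg, neg_neg]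
  rw [associator_apply, associator_apply, mul_sub] at hassoc
  rw [h.flexible, ← sub_left_inj, hassoc]

theorem op : IsAlternative Rᵐᵒᵖ where
  left x y := MulOpposite.unop_injective (h.right x.unop y.unop)
  right x y := MulOpposite.unop_injective (h.left x.unop y.unop)

theorem right_moufang (x y z : R) : z * x * y * x = z * (x * y * x) := by
  rw [h.flexible]
  exact MulOpposite.op_injective (h.op.left_moufang (.op x) (.op y) (.op z))

/-- By `middle_moufang`, the square of a commutator is a Jordan polynomial. -/
theorem commutator_mul_self (x y : R) :
    (x * y - y * x) * (x * y - y * x) =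
      (x * y + y * x) * (x * y + y * x) -
        2 • (x * (y * y) * x + y * (x * x) * y) := by
  rw [← h.middle_moufang, ← h.middle_moufang, sub_mul, mul_sub, mul_sub, add_mul, mul_add, mul_add]
  abel

end IsAlternative

/-- A not necessarily associative division algebra with an involution `x ↦ x̄` whose trace
`tr x = x + x̄` and norm `nm x = x̄ x` are scalars. The law `x̄ (x y) = nm x • y` encodes left
alternativity as well as `x̄ x = nm x • 1`. -/
structure CompositionDivisionAlgebra {K A : Type*} [Field K] [NonAssocRing A] [Module K A]
    (σ : Involution K A) where
  tr : A →ₗ[K] K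
  nm : A → K
  nontrivial : Nontrivial A
  smul_mul : ∀ (k : K) (x y : A), k • x * y = k • (x * y)
  mul_smul : ∀ (k : K) (x y : A), x * k • y = k • (x * y)
  add_conj : ∀ x, x + σ x = tr x • (1 : A)
  conj_mul_cancel : ∀ x y, σ x * (x * y) = nm x • y
  anisotropic : ∀ {x}, nm x = 0 → x = 0

namespace CompositionDivisionAlgebra

variable {K A : Type*} [Field K] [NonAssocRing A] [Module K A] {σ : Involution K A}
  (C : CompositionDivisionAlgebra σ)
include C

theorem smul_one_mul (k : K) (x : A) : k • (1 : A) * x = k • x := by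
  rw [C.smul_mul, one_mul]

theorem mul_smul_one (k : K) (x : A) : x * k • (1 : A) = k • x := by
  rw [C.mul_smul, mul_one]

theorem smul_one_injective : Function.Injective fun k : K => k • (1 : A) :=
  have := C.nontrivial
  smul_left_injective K one_ne_zero

theorem conj_eq (x : A) : σ x = C.tr x • (1 : A) - x := by
  rw [← C.add_conj, add_sub_cancel_left]

theorem tr_eq_of_add_conj {x : A} {t : K} (h : x + σ x = t • (1 : A)) : C.tr x = t :=
  C.smul_one_injective (by simp only [← C.add_conj, h])

theorem tr_one : C.tr 1 = 2 :=
  C.tr_eq_of_add_conj (by rw [σ.map_one, two_smul])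

theorem conj_mul_self (x : A) : σ x * x = C.nm x • (1 : A) := by
  simpa only [mul_one] using C.conj_mul_cancel x 1

theorem mul_conj (x : A) : x * σ x = C.nm x • (1 : A) := by
  rw [← C.conj_mul_self, C.conj_eq, mul_sub, sub_mul, C.smul_one_mul, C.mul_smul_one]

theorem nm_eq_of_mul_conj {x : A} {n : K} (h : x * σ x = n • (1 : A)) : C.nm x = n :=
  C.smul_one_injective (by simp only [← C.mul_conj, h])

theorem nm_conj (x : A) : C.nm (σ x) = C.nm x :=
  C.nm_eq_of_mul_conj (by rw [σ.involutive, C.conj_mul_self])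

theorem nm_one : C.nm 1 = 1 :=
  C.nm_eq_of_mul_conj (by rw [σ.map_one, one_mul, one_smul])

theorem nm_smul (k : K) (x : A) : C.nm (k • x) = k ^ 2 * C.nm x :=
  C.nm_eq_of_mul_conj (by
    rw [σ.map_smul, C.smul_mul, C.mul_smul, C.mul_conj, smul_smul, smul_smul, pow_two])

theorem nm_eq_zero {x : A} : C.nm x = 0 ↔ x = 0 :=
  ⟨C.anisotropic, fun h => C.nm_eq_of_mul_conj (by rw [h, zero_mul, zero_smul])⟩

theorem mul_self (x : A) : x * x = C.tr x • x - C.nm x • (1 : A) := by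
  rw [← C.mul_conj, C.conj_eq, mul_sub, C.mul_smul_one, sub_sub_cancel]

theorem isAlternative : IsAlternative A := by
  have left (x y : A) : x * (x * y) = x * x * y := by
    have h := C.conj_mul_cancel x y
    rw [C.conj_eq, sub_mul, C.smul_one_mul, sub_eq_iff_eq_add] at h
    rw [C.mul_self, sub_mul, C.smul_mul, C.smul_one_mul, h, add_sub_cancel_left]
  refine ⟨left, fun x y => ?_⟩
  have h := congrArg σ (left (σ x) (σ y))
  simpa only [σ.map_mul, σ.involutive] using h

theorem mul_conj_mul_cancel (x y : A) : x * (σ x * y) = C.nm x • y := by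
  simpa only [σ.involutive, C.nm_conj] using C.conj_mul_cancel (σ x) y

theorem mul_mul_conj_cancel (x y : A) : y * x * σ x = C.nm x • y := by
  have h := congrArg σ (C.mul_conj_mul_cancel x (σ y))
  simpa only [σ.map_mul, σ.map_smul, σ.involutive] using h

theorem associator_conj_left (x y z : A) : associator (σ x) y z = -associator x y z := by
  simp only [associator_apply, C.conj_eq, sub_mul, C.smul_one_mul, C.smul_mul]
  abel

theorem conj_associator (x y z : A) : σ (associator x y z) = -associator x y z := by
  have halt := C.isAlternative
  calc σ (associator x y z)
      = -associator (σ z) (σ y) (σ x) := by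
        simp only [associator_apply, sub_eq_add_neg, σ.map_add, σ.map_neg, σ.map_mul]; abel
    _ = associator z (σ y) (σ x) := by rw [C.associator_conj_left, neg_neg]
    _ = associator (σ x) y z := by
        rw [halt.associator_swap_left, C.associator_conj_left, neg_neg,
          halt.associator_swap_right, halt.associator_swap_left (σ x),
          halt.associator_swap_right (σ x), neg_neg]
    _ = -associator x y z := C.associator_conj_left x y z

theorem tr_mul_comm (x y : A) : C.tr (x * y) = C.tr (y * x) :=
  C.tr_eq_of_add_conj (by
    rw [← C.add_conj, σ.map_mul, σ.map_mul, C.conj_eq x, C.conj_eq y]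
    simp only [sub_mul, mul_sub, C.smul_one_mul, C.mul_smul_one, smul_sub,
      smul_comm (C.tr x) (C.tr y)]
    abel)

theorem tr_mul_assoc (x y z : A) : C.tr (x * y * z) = C.tr (x * (y * z)) := by
  rw [← sub_eq_zero, ← _root_.map_sub, ← associator_apply]
  exact C.tr_eq_of_add_conj (by rw [C.conj_associator, add_neg_cancel, zero_smul])

/-- The polar form of the norm. -/
def polar : A →ₗ[K] A →ₗ[K] K :=
  LinearMap.mk₂ K (fun x y => C.tr (x * σ y))
    (fun x y z => by rw [add_mul, _root_.map_add])
    (fun k x y => by rw [C.smul_mul, _root_.map_smul, smul_eq_mul])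
    (fun x y z => by rw [σ.map_add, mul_add, _root_.map_add])
    (fun k x y => by rw [σ.map_smul, C.mul_smul, _root_.map_smul, smul_eq_mul])

theorem polar_apply (x y : A) : C.polar x y = C.tr (x * σ y) := rfl

theorem polar_smul_one (x y : A) : C.polar x y • (1 : A) = x * σ y + y * σ x := by
  rw [polar_apply, ← C.add_conj, σ.map_mul, σ.involutive]

theorem polar_comm (x y : A) : C.polar x y = C.polar y x :=
  C.smul_one_injective (by simp only [C.polar_smul_one, add_comm])

theorem polar_self (x : A) : C.polar x x = 2 * C.nm x :=
  C.smul_one_injective (by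
    simp only [C.polar_smul_one, C.mul_conj, ← add_smul, two_mul])

theorem polar_one_right (x : A) : C.polar x 1 = C.tr x := by
  rw [polar_apply, σ.map_one, mul_one]

theorem nm_add (x y : A) : C.nm (x + y) = C.nm x + C.nm y + C.polar x y :=
  C.nm_eq_of_mul_conj (by
    rw [add_smul, add_smul, C.polar_smul_one, ← C.mul_conj, ← C.mul_conj, σ.map_add, mul_add,
      add_mul, add_mul]
    abel)

theorem nm_mul (x y : A) : C.nm (x * y) = C.nm x * C.nm y := by
  refine C.nm_eq_of_mul_conj ?_
  calc x * y * σ (x * y)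
      = C.tr x • (x * y * σ y) - x * y * (σ y * x) := by
        rw [σ.map_mul, C.conj_eq x, mul_sub, mul_sub, C.mul_smul_one, C.mul_smul]
    _ = C.nm y • (C.tr x • x - x * x) := by
        rw [C.isAlternative.middle_moufang, C.mul_conj, C.mul_mul_conj_cancel, C.mul_smul_one,
          C.smul_mul, smul_sub, smul_comm]
    _ = (C.nm x * C.nm y) • (1 : A) := by
        rw [C.mul_self, sub_sub_cancel, smul_smul, mul_comm]

theorem polar_mul_eq_polar_mul_conj (x y z : A) : C.polar (x * y) z = C.polar x (z * σ y) := by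
  rw [polar_apply, C.tr_mul_assoc, polar_apply, σ.map_mul, σ.involutive]

theorem polar_mul_eq_polar_conj_mul (x y z : A) : C.polar (x * y) z = C.polar y (σ x * z) := by
  rw [polar_apply, C.tr_mul_assoc, C.tr_mul_comm, C.tr_mul_assoc, polar_apply, σ.map_mul,
    σ.involutive]

theorem polar_mul_mul_left (x y z : A) : C.polar (x * y) (x * z) = C.nm x * C.polar y z := by
  rw [C.polar_mul_eq_polar_conj_mul, C.conj_mul_cancel, _root_.map_smul, smul_eq_mul]

theorem conj_mul_mul_add (x y z : A) :
    σ x * (y * z) + σ y * (x * z) = C.polar x y • z := by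
  have h := C.conj_mul_cancel (x + y) z
  simp only [C.nm_add, σ.map_add, add_mul, mul_add, C.conj_mul_cancel, add_smul] at h
  rw [← sub_eq_zero] at h ⊢
  rw [← h]
  abel

theorem mul_mul_conj_add (x y z : A) :
    z * x * σ y + z * y * σ x = C.polar x y • z := by
  have h := C.mul_mul_conj_cancel (x + y) z
  simp only [C.nm_add, σ.map_add, add_mul, mul_add, C.mul_mul_conj_cancel, add_smul] at h
  rw [← sub_eq_zero] at h ⊢
  rw [← h]
  abel

section Inverse

/-- The inverse `(nm x)⁻¹ • x̄`; the inverse of `0` is `0`. -/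
def inv (x : A) : A := (C.nm x)⁻¹ • σ x

theorem nm_inv (x : A) : C.nm (C.inv x) = (C.nm x)⁻¹ := by
  rw [inv, C.nm_smul, C.nm_conj]
  rcases eq_or_ne (C.nm x) 0 with h | h
  · rw [h, inv_zero, mul_zero]
  · field_simp

theorem inv_inv (x : A) : C.inv (C.inv x) = x := by
  rcases eq_or_ne x 0 with rfl | hx
  · simp only [inv, σ.map_zero, smul_zero]
  · rw [inv, C.nm_inv, inv, σ.map_smul, σ.involutive, _root_.inv_inv,
      smul_inv_smul₀ (mt C.anisotropic hx)]

theorem inv_ne_zero {x : A} (hx : x ≠ 0) : C.inv x ≠ 0 := by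
  rwa [ne_eq, ← C.nm_eq_zero, C.nm_inv, inv_eq_zero, C.nm_eq_zero]

theorem inv_mul_rev (x y : A) : C.inv (x * y) = C.inv y * C.inv x := by
  rw [inv, inv, inv, C.nm_mul, σ.map_mul, C.smul_mul, C.mul_smul, smul_smul, mul_inv_rev]

variable {x : A}

theorem inv_mul_cancel_left (hx : x ≠ 0) (y : A) : C.inv x * (x * y) = y := by
  rw [inv, C.smul_mul, C.conj_mul_cancel, inv_smul_smul₀ (mt C.anisotropic hx)]

theorem mul_inv_cancel_left (hx : x ≠ 0) (y : A) : x * (C.inv x * y) = y := by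
  rw [inv, C.smul_mul, C.mul_smul, C.mul_conj_mul_cancel, inv_smul_smul₀ (mt C.anisotropic hx)]

theorem mul_inv_cancel_right (hx : x ≠ 0) (y : A) : y * x * C.inv x = y := by
  rw [inv, C.mul_smul, C.mul_mul_conj_cancel, inv_smul_smul₀ (mt C.anisotropic hx)]

theorem inv_mul_cancel_right (hx : x ≠ 0) (y : A) : y * C.inv x * x = y := by
  simpa only [C.inv_inv] using C.mul_inv_cancel_right (C.inv_ne_zero hx) y

theorem mul_inv_cancel (hx : x ≠ 0) : x * C.inv x = 1 := by
  simpa only [mul_one] using C.mul_inv_cancel_left hx 1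

theorem inv_mul_cancel (hx : x ≠ 0) : C.inv x * x = 1 := by
  simpa only [mul_one] using C.inv_mul_cancel_left hx 1

theorem inv_eq_of_mul_eq_one {y : A} (h : x * y = 1) : C.inv x = y := by
  have := C.nontrivial
  have hx : x ≠ 0 := by
    rintro rfl
    exact zero_ne_one (by rwa [zero_mul] at h)
  rw [← C.inv_mul_cancel_left hx y, h, mul_one]

theorem eq_zero_or_eq_zero_of_mul_eq_zero {y : A} (h : x * y = 0) : x = 0 ∨ y = 0 := by
  rw [← C.nm_eq_zero, ← C.nm_eq_zero (x := y), ← mul_eq_zero, ← C.nm_mul, h, C.nm_eq_zero]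

theorem mul_left_injective_of_ne_zero (hx : x ≠ 0) : Function.Injective (x * ·) :=
  Function.LeftInverse.injective (C.inv_mul_cancel_left hx)

end Inverse

section Orthogonal

variable {e x y : A}

theorem conj_of_tr_eq_zero (he : C.tr e = 0) : σ e = -e := by
  rw [C.conj_eq, he, zero_smul, zero_sub]

theorem conj_eq_self_of_tr_eq_zero (hone : C.tr 1 = 0) (he : C.tr e = 0) : σ e = e := by
  rw [C.conj_of_tr_eq_zero he, ← neg_one_mul, ← C.conj_of_tr_eq_zero hone, σ.map_one, one_mul]

theorem tr_eq_zero_of_polar_mul_eq_zero (he : e ≠ 0) (hx : C.polar e (e * x) = 0) :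
    C.tr x = 0 := by
  have hmul := C.polar_mul_mul_left e 1 x
  rw [mul_one, hx, zero_eq_mul, C.polar_comm, C.polar_one_right] at hmul
  exact hmul.resolve_left (mt C.nm_eq_zero.1 he)

theorem polar_conj_eq_zero (he : C.tr e = 0) (hx : C.polar e x = 0) : C.polar e (σ x) = 0 := by
  rw [C.conj_eq, _root_.map_sub, _root_.map_smul, C.polar_one_right, he, hx, smul_zero, sub_zero]

theorem conj_mul_orth (he : C.tr e = 0) (hx : C.polar e x = 0) (y : A) :
    σ x * (e * y) = e * (x * y) := by
  have h := C.conj_mul_mul_add x e y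
  rwa [C.polar_comm, hx, zero_smul, C.conj_of_tr_eq_zero he, neg_mul, ← sub_eq_add_neg,
    sub_eq_zero] at h

theorem mul_orth (he : C.tr e = 0) (hx : C.polar e x = 0) (y : A) :
    x * (e * y) = e * (σ x * y) := by
  simpa only [σ.involutive] using C.conj_mul_orth he (C.polar_conj_eq_zero he hx) y

theorem orth_comm (he : C.tr e = 0) (hx : C.polar e x = 0) : e * x = σ x * e := by
  simpa only [mul_one] using (C.conj_mul_orth he hx 1).symm

theorem orth_mul (he : C.tr e = 0) (hx : C.polar e x = 0) (hy : C.polar e y = 0)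
    (hyx : C.polar e (y * x) = 0) : e * x * y = e * (y * x) := by
  have h := C.mul_mul_conj_add e (σ y) (σ x)
  rw [C.polar_conj_eq_zero he hy, zero_smul, σ.involutive, C.conj_of_tr_eq_zero he, mul_neg,
    ← sub_eq_add_neg, sub_eq_zero] at h
  rw [C.orth_comm he hx, h, C.orth_comm he hyx, σ.map_mul]

theorem orth_mul_orth (he : C.tr e = 0) (hy : C.polar e y = 0) (hxy : C.polar e (x * σ y) = 0) :
    e * x * (e * y) = -C.nm e • (y * σ x) := by
  have halt := C.isAlternative
  rw [C.orth_comm he hy, halt.middle_moufang, C.orth_comm he hxy, halt.right, C.mul_self, he,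
    σ.map_mul, σ.involutive, zero_smul, zero_sub, mul_neg, C.mul_smul_one, neg_smul]

end Orthogonal

end CompositionDivisionAlgebra

namespace CompositionDivisionAlgebra

variable {K A : Type*} [Field K] [NonAssocRing A] [Module K A] {σ : Involution K A}
  (C : CompositionDivisionAlgebra σ)
include C

theorem add_orth_mul_add_orth {e x y p q : A} (he : C.tr e = 0) (hx : C.polar e x = 0)
    (hy : C.polar e y = 0) (hp : C.polar e p = 0) (hq : C.polar e q = 0)
    (hpy : C.polar e (p * y) = 0) (hyq : C.polar e (y * σ q) = 0) :
    (x + e * y) * (p + e * q) =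
      x * p - C.nm e • (q * σ y) + e * (σ x * q + p * y) := by
  rw [mul_add, add_mul, add_mul, C.mul_orth he hx, C.orth_mul he hy hp hpy,
    C.orth_mul_orth he hq hyq, neg_smul, mul_add]
  abel

theorem exists_tr_eq_one (hA : ∃ x y : A, ¬Commute x y) : ∃ x, C.tr x = 1 := by
  obtain ⟨x, hx⟩ : ∃ x, C.tr x ≠ 0 := by
    by_contra! h
    obtain ⟨x, y, hxy⟩ := hA
    have hσ (z : A) : σ z = z := C.conj_eq_self_of_tr_eq_zero (h 1) (h z)
    exact hxy (by rw [commute_iff_eq, ← hσ (x * y), σ.map_mul, hσ, hσ])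
  exact ⟨(C.tr x)⁻¹ • x, by rw [_root_.map_smul, smul_eq_mul, inv_mul_cancel₀ hx]⟩

/-- Put `d = z̄ - z`. All products `x d` lie in the span of `1` and `z`, so they commute, and the
middle Moufang identity turns this into `d (x y) d = d (y x) d`. -/
theorem exists_eq_smul_one_of_forall_commute (hA : ∃ x y : A, ¬Commute x y) {z : A}
    (hz : ∀ x, Commute z x) : ∃ k : K, z = k • (1 : A) := by
  have halt := C.isAlternative
  have hd (x : A) : x * (σ z - z) = C.polar x z • (1 : A) - C.tr x • z := by
    have h := C.polar_smul_one x z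
    rw [(hz _).eq, C.conj_eq x, sub_mul, C.smul_one_mul] at h
    rw [h, mul_sub]
    abel
  have hd_comm (x : A) : (σ z - z) * x = x * (σ z - z) := by
    rw [C.conj_eq, sub_mul, mul_sub, sub_mul, mul_sub, C.smul_one_mul, C.mul_smul_one, (hz x).eq]
  rcases eq_or_ne (σ z - z) 0 with hd0 | hd0
  · obtain ⟨x, hx⟩ := C.exists_tr_eq_one hA
    refine ⟨C.polar x z, ?_⟩
    have h := hd x
    rwa [hd0, mul_zero, hx, one_smul, eq_comm, sub_eq_zero, eq_comm] at h
  · obtain ⟨x, y, hxy⟩ := hA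
    have hcomm : x * (σ z - z) * (y * (σ z - z)) = y * (σ z - z) * (x * (σ z - z)) := by
      simp only [hd, mul_sub, sub_mul, C.mul_smul_one, C.smul_one_mul, C.smul_mul, C.mul_smul,
        smul_sub, smul_comm (C.tr x), smul_comm (C.polar x z)]
      abel
    rw [← hd_comm x, ← hd_comm y, hd_comm y, halt.middle_moufang, ← hd_comm y, hd_comm x,
      halt.middle_moufang, halt.flexible, halt.flexible] at hcomm
    have hinj := C.mul_left_injective_of_ne_zero hd0
    have h := hinj hcomm
    simp only [← hd_comm] at h
    exact absurd (hinj h) hxy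

theorem injective_of_map_one_ne_zero {B F : Type*} [NonUnitalNonAssocRing B] [FunLike F A B]
    [NonUnitalRingHomClass F A B] (f : F) (hf : f 1 ≠ 0) : Function.Injective f := by
  rw [injective_iff_map_eq_zero]
  intro x hx
  by_contra hx0
  exact hf (by rw [← C.mul_inv_cancel hx0, _root_.map_mul, hx, zero_mul])

end CompositionDivisionAlgebra

namespace Doubling

variable {K A : Type*} [CommRing K] [NonAssocRing A] [Module K A] {σ : Involution K A} {β : K}

@[simp] theorem fst_conj (z : Doubling σ β) : (conj σ β z).fst = σ z.fst := rfl
@[simp] theorem snd_conj (z : Doubling σ β) : (conj σ β z).snd = -z.snd := rfl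

/-- The first component as a linear map. -/
def fstₗ : Doubling σ β →ₗ[K] A where
  toFun := fst
  map_add' := fst_add
  map_smul' := fst_smul

instance [Nontrivial A] : Nontrivial (Doubling σ β) := inferInstanceAs (Nontrivial (A × A))

end Doubling

namespace CompositionDivisionAlgebra

variable {K A B : Type*} [Field K] [NonAssocRing A] [Module K A] [NonAssocRing B] [Module K B]
  {σ : Involution K A}

theorem eq_zero_of_nm_eq_mul_nm (C : CompositionDivisionAlgebra σ) {β : K}
    (hβ : ¬σ.IsNormValue β) {x y : A} (h : C.nm x = β * C.nm y) : y = 0 := by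
  by_contra hy
  have hy' := mt C.anisotropic hy
  refine hβ ⟨x * C.inv y, ?_⟩
  rw [C.mul_conj, C.nm_mul, C.nm_inv, h, mul_assoc, mul_inv_cancel₀ hy', mul_one]

/-- The double of an associative division algebra of this kind, with respect to a scalar that is
not a norm; its norm is `x + e · y ↦ nm x - β nm y`. -/
def double (C : CompositionDivisionAlgebra σ) (hassoc : ∀ x y z : A, x * y * z = x * (y * z))
    {β : K} (hβ : ¬σ.IsNormValue β) : CompositionDivisionAlgebra (Doubling.conj σ β) where
  tr := C.tr ∘ₗ Doubling.fstₗ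
  nm z := C.nm z.fst - β * C.nm z.snd
  nontrivial := have := C.nontrivial; inferInstance
  smul_mul k z t := by
    ext <;> simp [Involution.map_smul, smul_add, C.smul_mul, C.mul_smul, smul_comm k β]
  mul_smul k z t := by
    ext <;> simp [smul_add, C.smul_mul, C.mul_smul, smul_comm k β]
  add_conj z := by
    ext <;> simp [C.add_conj, Doubling.fstₗ]
  conj_mul_cancel z t := by
    ext
    · simp only [Doubling.fst_mul, Doubling.snd_mul, Doubling.fst_conj, Doubling.snd_conj,
        Doubling.fst_smul, mul_add, add_mul, σ.map_neg, mul_neg, C.mul_smul, C.conj_mul_cancel]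
      rw [C.mul_mul_conj_cancel, hassoc, sub_smul, SemigroupAction.mul_smul, smul_neg,
        smul_add]
      abel
    · simp only [Doubling.fst_mul, Doubling.snd_mul, Doubling.fst_conj, Doubling.snd_conj,
        Doubling.snd_smul, add_mul, mul_add, mul_neg, σ.involutive, C.smul_mul]
      rw [C.mul_conj_mul_cancel, hassoc, hassoc, C.conj_mul_self, C.mul_smul_one, sub_smul,
        SemigroupAction.mul_smul]
      abel
  anisotropic {z} hz := by
    have hsnd := C.eq_zero_of_nm_eq_mul_nm hβ (sub_eq_zero.1 hz)
    rw [hsnd, C.nm_eq_zero.2 rfl, mul_zero, sub_zero] at hz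
    exact Doubling.ext (C.anisotropic hz) hsnd

/-- Transport of the structure along a multiplicative linear equivalence that commutes with the
involutions. -/
def ofEquiv (C : CompositionDivisionAlgebra σ) {τ : Involution K B} (f : B ≃ₗ[K] A)
    (hmul : ∀ x y, f (x * y) = f x * f y) (hconj : ∀ x, f (τ x) = σ (f x)) :
    CompositionDivisionAlgebra τ where
  tr := C.tr ∘ₗ f
  nm x := C.nm (f x)
  nontrivial := have := C.nontrivial; f.toEquiv.nontrivial
  smul_mul k x y := f.injective (by simp only [hmul, _root_.map_smul, C.smul_mul])
  mul_smul k x y := f.injective (by simp only [hmul, _root_.map_smul, C.mul_smul])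
  add_conj x := f.injective (by
    have hone : f 1 = 1 := _root_.map_one (MulEquiv.mk f.toEquiv hmul)
    simp only [_root_.map_add, _root_.map_smul, hconj, hone, C.add_conj, LinearMap.comp_apply,
      LinearEquiv.coe_coe])
  conj_mul_cancel x y := f.injective (by
    simp only [hmul, _root_.map_smul, hconj, C.conj_mul_cancel])
  anisotropic hx := f.map_eq_zero_iff.1 (C.anisotropic hx)

end CompositionDivisionAlgebra

namespace Doubling

theorem finrank_eq {K A : Type*} [Field K] [NonAssocRing A] [Module K A] [Module.Finite K A]
    (σ : Involution K A) (β : K) :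
    Module.finrank K (Doubling σ β) = 2 * Module.finrank K A := by
  rw [two_mul, ← Module.finrank_prod]
  rfl

end Doubling

namespace QuaternionData

variable {K : Type u} [Field K] (D : QuaternionData.{u, v} K)

instance : Module.Finite K D.E := Module.finite_of_finrank_eq_succ D.finrank_eq

theorem finrank_alg : Module.finrank K D.Alg = 4 := by
  rw [Doubling.finrank_eq, D.finrank_eq]

instance : Module.Finite K D.Alg := Module.finite_of_finrank_eq_succ D.finrank_alg

theorem exists_eq_smul_one_add_smul {x : D.E} (hx : ∀ k : K, x ≠ k • 1) (y : D.E) :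
    ∃ a b : K, a • 1 + b • x = y := by
  have hli : LinearIndependent K ![1, x] :=
    (LinearIndependent.pair_iff' one_ne_zero).2 fun k h => hx k h.symm
  have hspan := hli.span_eq_top_of_card_eq_finrank (by simp [D.finrank_eq])
  rw [Matrix.range_cons, Matrix.range_cons, Matrix.range_empty, Set.union_empty,
    Set.singleton_union] at hspan
  exact Submodule.mem_span_pair.1 (hspan ▸ Submodule.mem_top)

theorem exists_eq_smul_one_of_fixed {x : D.E} (hx : D.σ x = x) : ∃ k : K, x = k • 1 := by
  by_contra! hne
  obtain ⟨y, hy⟩ := D.σ_nontrivial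
  obtain ⟨a, b, rfl⟩ := D.exists_eq_smul_one_add_smul hne y
  exact hy (by rw [D.σ.map_add, D.σ.map_smul, D.σ.map_smul, D.σ.map_one, hx])

theorem exists_add_conj (x : D.E) : ∃ t : K, x + D.σ x = t • 1 :=
  D.exists_eq_smul_one_of_fixed (by rw [D.σ.map_add, D.σ.involutive, add_comm])

theorem exists_conj_mul_self (x : D.E) : ∃ n : K, D.σ x * x = n • 1 :=
  D.exists_eq_smul_one_of_fixed (by rw [D.σ.map_mul, D.σ.involutive])

/-- The trace of the quadratic extension `E`. -/
noncomputable def trace (x : D.E) : K := (D.exists_add_conj x).choose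

/-- The norm of the quadratic extension `E`. -/
noncomputable def norm (x : D.E) : K := (D.exists_conj_mul_self x).choose

theorem add_conj (x : D.E) : x + D.σ x = D.trace x • 1 := (D.exists_add_conj x).choose_spec

theorem conj_mul_self (x : D.E) : D.σ x * x = D.norm x • 1 :=
  (D.exists_conj_mul_self x).choose_spec

/-- The quadratic extension `E`, with its non-trivial automorphism as involution. -/
noncomputable def fieldComposition : CompositionDivisionAlgebra D.σ where
  tr :=
    { toFun := D.trace
      map_add' := fun x y => smul_left_injective K (one_ne_zero (α := D.E)) (by
        simp only [add_smul, ← D.add_conj, D.σ.map_add]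
        ring)
      map_smul' := fun k x => smul_left_injective K (one_ne_zero (α := D.E)) (by
        simp only [RingHom.id_apply, smul_assoc, ← D.add_conj, D.σ.map_smul, smul_add]) }
  nm := D.norm
  nontrivial := inferInstance
  smul_mul := smul_mul_assoc
  mul_smul := mul_smul_comm
  add_conj := D.add_conj
  conj_mul_cancel x y := by rw [← mul_assoc, D.conj_mul_self, smul_one_mul]
  anisotropic {x} hx := by
    have h := D.conj_mul_self x
    rw [hx, zero_smul] at h
    refine (mul_eq_zero.1 h).elim (fun hσ => ?_) id
    rw [← D.σ.involutive x, hσ, D.σ.map_zero]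

/-- The quaternion division algebra `(E/K, b)` with its standard involution. -/
noncomputable def composition : CompositionDivisionAlgebra D.conj :=
  D.fieldComposition.double _root_.mul_assoc D.b_not_norm

theorem mul_assoc (x y z : D.Alg) : x * y * z = x * (y * z) := by
  have hσ (k : K) : D.σ (algebraMap K D.E k) = algebraMap K D.E k := by
    rw [Algebra.algebraMap_eq_smul_one, D.σ.map_smul, D.σ.map_one]
  ext <;>
  simp only [Doubling.fst_mul, Doubling.snd_mul, D.σ.map_add, D.σ.map_mul, D.σ.involutive,
    Algebra.smul_def, hσ] <;> ring

theorem exists_not_commute : ∃ x y : D.Alg, ¬Commute x y := by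
  obtain ⟨x, hx⟩ := D.σ_nontrivial
  refine ⟨Doubling.mk x 0, Doubling.mk 0 1, fun h => hx ?_⟩
  simpa [Involution.map_zero] using congrArg Doubling.snd h

end QuaternionData

namespace OctonionDivisionAlgebra

variable {K : Type u} {O : Type v} [Field K] [NonAssocRing O] [Module K O]
  (P : OctonionDivisionAlgebra K O)

theorem equiv_conj (x : O) : P.equiv (P.conj x) = Doubling.conj P.H.conj P.c (P.equiv x) :=
  P.equiv.apply_symm_apply _

/-- `OctonionDivisionAlgebra.conj` as an involution. -/
def conjInvolution : Involution K O where
  toFun := P.conj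
  map_add' x y := P.equiv.injective (by simp only [equiv_conj, map_add, Involution.map_add])
  map_smul' k x := P.equiv.injective (by
    simp only [equiv_conj, map_smul, Involution.map_smul, RingHom.id_apply])
  map_mul' x y := P.equiv.injective (by simp only [equiv_conj, P.map_mul, Involution.map_mul])
  involutive' x := P.equiv.injective (by simp only [equiv_conj, Involution.involutive])

/-- An octonion division algebra with its standard involution, trace and norm. -/
noncomputable def composition : CompositionDivisionAlgebra P.conjInvolution :=
  (P.H.composition.double P.H.mul_assoc P.c_not_norm).ofEquiv P.equiv P.map_mul P.equiv_conj

theorem finrank_eq (P : OctonionDivisionAlgebra K O) : Module.finrank K O = 8 := by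
  rw [P.equiv.finrank_eq, Doubling.finrank_eq, P.H.finrank_alg]

theorem exists_not_commute (P : OctonionDivisionAlgebra K O) : ∃ x y : O, ¬Commute x y := by
  obtain ⟨x, y, h⟩ := P.H.exists_not_commute
  refine ⟨P.equiv.symm (Doubling.mk x 0), P.equiv.symm (Doubling.mk y 0), fun hcomm => h ?_⟩
  have h' := congrArg P.equiv hcomm.eq
  simp only [P.map_mul, P.equiv.apply_symm_apply] at h'
  simpa [Involution.map_zero, commute_iff_eq] using congrArg Doubling.fst h'

theorem bilin_eq (x y : O) : P.bilin x y = P.composition.polar x y • (1 : O) :=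
  (P.composition.polar_smul_one x y).symm

end OctonionDivisionAlgebra

namespace jordanAut

variable {A : Type*} [NonAssocRing A]

instance : FunLike (jordanAut A) A A where
  coe γ := γ.1
  coe_injective _ _ h := Subtype.ext (DFunLike.coe_injective h)

instance : AddMonoidHomClass (jordanAut A) A A where
  map_add γ := γ.2.1
  map_zero γ := by
    have h := γ.2.1 0 0
    rw [add_zero] at h
    exact left_eq_add.1 h

instance : OneHomClass (jordanAut A) A A where
  map_one γ := γ.2.2.1

variable (γ δ : jordanAut A)

@[simp] theorem mul_apply (x : A) : (γ * δ) x = γ (δ x) := rfl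

@[simp] theorem inv_apply_self (x : A) : γ⁻¹ (γ x) = x := γ.1.symm_apply_apply x

@[simp] theorem apply_inv_self (x : A) : γ (γ⁻¹ x) = x := γ.1.apply_symm_apply x

theorem injective : Function.Injective γ := γ.1.injective

theorem surjective : Function.Surjective γ := γ.1.surjective

theorem map_ne_zero {x : A} (hx : x ≠ 0) : γ x ≠ 0 :=
  (map_ne_zero_iff γ (injective γ)).2 hx

theorem map_triple (x y : A) : γ (x * y * x) = γ x * γ y * γ x := γ.2.2.2 x y

theorem map_mul_self (x : A) : γ (x * x) = γ x * γ x := by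
  simpa only [mul_one, map_one] using map_triple γ x 1

theorem map_mul_add_mul (x y : A) : γ (x * y + y * x) = γ x * γ y + γ y * γ x := by
  have h := map_mul_self γ (x + y)
  simp only [add_mul, mul_add, map_add, map_mul_self] at h
  rw [map_add, ← sub_eq_zero, ← sub_eq_zero.2 h]
  abel

theorem map_mul_swap {x y : A} (h : γ (x * y) = γ x * γ y) : γ (y * x) = γ y * γ x := by
  rwa [← add_right_inj (γ (x * y)), ← map_add, map_mul_add_mul, add_left_inj, eq_comm]

theorem map_commutator_mul_self (hA : IsAlternative A) (x y : A) :
    γ ((x * y - y * x) * (x * y - y * x)) =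
      (γ x * γ y - γ y * γ x) * (γ x * γ y - γ y * γ x) := by
  simp only [hA.commutator_mul_self, map_sub, map_nsmul, map_mul_self, map_mul_add_mul]
  simp only [map_add, map_triple, map_mul_self]

end jordanAut

/-- With `d = f (a b) - f a f b`, the additive identity `2 d = 0` and `f (a b)² = (f a f b)²` give
`d² = 0`, in every characteristic. -/
theorem map_mul_of_map_triple {R S : Type*} [CommRing R] [CommRing S] [NoZeroDivisors S]
    (f : R →+ S) (hone : f 1 = 1) (htriple : ∀ a b, f (a * b * a) = f a * f b * f a) (a b : R) :
    f (a * b) = f a * f b := by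
  have hsq (c : R) : f (c * c) = f c * f c := by simpa only [mul_one, hone] using htriple c 1
  have htwo : 2 * (f (a * b) - f a * f b) = 0 := by
    have h := hsq (a + b)
    rw [show (a + b) * (a + b) = a * a + b * b + (a * b + a * b) by ring] at h
    simp only [map_add, hsq] at h
    linear_combination h
  have hmul : f (a * b) * f (a * b) = f a * f b * (f a * f b) := by
    rw [← hsq, show a * b * (a * b) = a * (b * b) * a by ring, htriple, hsq]
    ring
  have hd : (f (a * b) - f a * f b) ^ 2 = 0 := by
    linear_combination hmul - f a * f b * htwo
  exact sub_eq_zero.1 (pow_eq_zero_iff two_ne_zero |>.1 hd)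

namespace CompositionDivisionAlgebra

variable {K A : Type*} [Field K] [NonAssocRing A] [Module K A] {σ : Involution K A}
  (C : CompositionDivisionAlgebra σ) (γ : jordanAut A)
include C

theorem commute_map {x y : A} (h : Commute x y) : Commute (γ x) (γ y) := by
  have hsq := jordanAut.map_commutator_mul_self γ C.isAlternative x y
  rw [h.eq, sub_self, zero_mul, map_zero, eq_comm] at hsq
  exact sub_eq_zero.1 (C.eq_zero_or_eq_zero_of_mul_eq_zero hsq |>.elim id id)

theorem exists_map_smul_one (hA : ∃ x y : A, ¬Commute x y) (k : K) :
    ∃ l : K, γ (k • (1 : A)) = l • (1 : A) := by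
  refine C.exists_eq_smul_one_of_forall_commute hA fun x => ?_
  obtain ⟨y, rfl⟩ := jordanAut.surjective γ x
  exact C.commute_map γ (by rw [commute_iff_eq, C.smul_one_mul, C.mul_smul_one])

variable (hA : ∃ x y : A, ¬Commute x y)

/-- The map that a Jordan automorphism induces on scalars. -/
noncomputable def scalar (k : K) : K := (C.exists_map_smul_one γ hA k).choose

theorem map_smul_one (k : K) : γ (k • (1 : A)) = C.scalar γ hA k • (1 : A) :=
  (C.exists_map_smul_one γ hA k).choose_spec

theorem scalar_one : C.scalar γ hA 1 = 1 :=
  C.smul_one_injective (by simp only [← C.map_smul_one γ hA, one_smul, map_one])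

theorem scalar_add (k l : K) : C.scalar γ hA (k + l) = C.scalar γ hA k + C.scalar γ hA l :=
  C.smul_one_injective (by simp only [← C.map_smul_one γ hA, add_smul, map_add])

theorem scalar_triple (k l : K) :
    C.scalar γ hA (k * l * k) = C.scalar γ hA k * C.scalar γ hA l * C.scalar γ hA k :=
  C.smul_one_injective (by
    have h := jordanAut.map_triple γ (k • (1 : A)) (l • (1 : A))
    simpa only [C.smul_one_mul, C.mul_smul_one, C.map_smul_one γ hA, smul_smul, mul_comm,
      mul_left_comm] using h)

/-- The ring endomorphism of the ground field that a Jordan automorphism induces; the Jordan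
automorphism is semilinear over it. -/
noncomputable def scalarHom : K →+* K :=
  { AddMonoidHom.mk' (C.scalar γ hA) (C.scalar_add γ hA) with
    map_one' := C.scalar_one γ hA
    map_mul' := map_mul_of_map_triple (AddMonoidHom.mk' _ (C.scalar_add γ hA))
      (C.scalar_one γ hA) (C.scalar_triple γ hA) }

theorem map_smul_one_eq_scalarHom (k : K) : γ (k • (1 : A)) = C.scalarHom γ hA k • (1 : A) :=
  C.map_smul_one γ hA k

theorem map_smul_of_tr_eq_one (k : K) {x : A} (hx : C.tr x = 1) :
    γ (k • x) = C.scalarHom γ hA k • γ x := by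
  have h := jordanAut.map_triple γ x (k • (1 : A))
  rw [C.map_smul_one_eq_scalarHom γ hA, C.mul_smul_one, C.mul_smul_one, C.smul_mul, C.smul_mul,
    ← jordanAut.map_mul_self γ, C.mul_self, hx, one_smul, smul_sub, smul_smul, map_sub, map_sub,
    C.map_smul_one_eq_scalarHom γ hA, C.map_smul_one_eq_scalarHom γ hA, map_mul, smul_sub,
    smul_smul] at h
  simpa only [sub_left_inj] using h

/-- Adding to `x` a multiple of an element of trace one reduces to the case `tr x = 1`. -/
protected theorem map_smul (k : K) (x : A) : γ (k • x) = C.scalarHom γ hA k • γ x := by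
  obtain ⟨y, hy⟩ := C.exists_tr_eq_one hA
  have h := C.map_smul_of_tr_eq_one γ hA k (x := x + (1 - C.tr x) • y) (by
    rw [map_add, map_smul, hy, smul_eq_mul, mul_one, add_sub_cancel])
  rw [smul_add, smul_smul, map_add, map_add, C.map_smul_of_tr_eq_one γ hA _ hy,
    C.map_smul_of_tr_eq_one γ hA _ hy, map_mul, smul_add, smul_smul] at h
  exact add_right_cancel h

theorem tr_map_and_nm_map_of_forall_ne {x : A} (hx : ∀ k : K, x ≠ k • (1 : A)) :
    C.tr (γ x) = C.scalarHom γ hA (C.tr x) ∧ C.nm (γ x) = C.scalarHom γ hA (C.nm x) := by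
  set t := C.scalarHom γ hA (C.tr x) - C.tr (γ x)
  set n := C.scalarHom γ hA (C.nm x) - C.nm (γ x)
  have htn : t • γ x = n • (1 : A) := by
    have h := jordanAut.map_mul_self γ x
    rw [C.mul_self, C.mul_self, map_sub, C.map_smul γ hA, C.map_smul_one_eq_scalarHom γ hA] at h
    rw [sub_smul, sub_smul, sub_eq_sub_iff_sub_eq_sub, h]
  have ht : t = 0 := by
    by_contra ht
    apply hx (C.scalarHom γ⁻¹ hA (t⁻¹ * n))
    rw [← C.map_smul_one_eq_scalarHom, SemigroupAction.mul_smul, ← htn, inv_smul_smul₀ ht,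
      jordanAut.inv_apply_self]
  have hn : n = 0 := C.smul_one_injective (by simp only [← htn, ht, zero_smul])
  exact ⟨(sub_eq_zero.1 ht).symm, (sub_eq_zero.1 hn).symm⟩

theorem tr_map_and_nm_map (x : A) :
    C.tr (γ x) = C.scalarHom γ hA (C.tr x) ∧ C.nm (γ x) = C.scalarHom γ hA (C.nm x) := by
  by_cases hx : ∃ k : K, x = k • (1 : A)
  · obtain ⟨k, rfl⟩ := hx
    simp only [C.map_smul_one_eq_scalarHom γ hA, map_smul, smul_eq_mul, C.nm_smul, C.tr_one,
      C.nm_one, map_mul, map_pow, map_ofNat, map_one, and_self]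
  · exact C.tr_map_and_nm_map_of_forall_ne γ hA (not_exists.1 hx)

theorem tr_map (x : A) : C.tr (γ x) = C.scalarHom γ hA (C.tr x) :=
  (C.tr_map_and_nm_map γ hA x).1

theorem nm_map (x : A) : C.nm (γ x) = C.scalarHom γ hA (C.nm x) :=
  (C.tr_map_and_nm_map γ hA x).2

include hA in
theorem map_conj (x : A) : γ (σ x) = σ (γ x) := by
  rw [C.conj_eq, C.conj_eq, map_sub, C.map_smul_one_eq_scalarHom γ hA, C.tr_map γ hA]

theorem polar_map (x y : A) : C.polar (γ x) (γ y) = C.scalarHom γ hA (C.polar x y) := by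
  have h := C.nm_add (γ x) (γ y)
  rw [← map_add, C.nm_map γ hA, C.nm_add, C.nm_map γ hA, C.nm_map γ hA, map_add, map_add,
    add_right_inj] at h
  exact h.symm

/-- The involution of `A` as a Jordan automorphism. -/
def conjJordan : jordanAut A :=
  ⟨⟨σ, σ, σ.involutive, σ.involutive⟩, σ.map_add, σ.map_one, fun x y => by
    simp only [Equiv.coe_fn_mk, σ.map_mul, C.isAlternative.flexible]⟩

theorem conjJordan_apply (x : A) : C.conjJordan x = σ x := rfl

include hA in
theorem conjJordan_mem_center : C.conjJordan ∈ Subgroup.center (jordanAut A) :=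
  Subgroup.mem_center_iff.2 fun γ => DFunLike.ext _ _ fun x => C.map_conj γ hA x

theorem conjJordan_mul_self : C.conjJordan * C.conjJordan = 1 :=
  DFunLike.ext _ _ fun x => σ.involutive x

end CompositionDivisionAlgebra

namespace CompositionDivisionAlgebra

variable {K A : Type*} [Field K] [NonAssocRing A] [Module K A] {σ : Involution K A}
  (C : CompositionDivisionAlgebra σ)
include C

theorem map_inv (γ : jordanAut A) {x : A} (hx : x ≠ 0) : γ (C.inv x) = C.inv (γ x) := by
  have hγx := jordanAut.map_ne_zero γ hx
  refine (C.inv_eq_of_mul_eq_one ?_).symm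
  calc γ x * γ (C.inv x) = γ x * γ (C.inv x) * γ x * C.inv (γ x) :=
        (C.mul_inv_cancel_right hγx _).symm
    _ = γ (x * C.inv x * x) * C.inv (γ x) := by rw [jordanAut.map_triple]
    _ = 1 := by rw [C.mul_inv_cancel hx, one_mul, C.mul_inv_cancel hγx]

theorem mul_isotope_mul {a : A} (ha : a ≠ 0) (x y : A) :
    a * (x * C.inv a * (a * y)) = a * x * y := by
  rw [C.isAlternative.left_moufang, C.isAlternative.flexible, C.inv_mul_cancel_right ha]

theorem isotope_mul_mul_inv {a : A} (ha : a ≠ 0) (x y : A) :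
    x * C.inv a * (a * y) * C.inv a = x * (y * C.inv a) := by
  rw [C.isAlternative.right_moufang, C.inv_mul_cancel_left ha]

/-- `f` is multiplicative from `A` to the isotope of `A` with multiplication
`(x, y) ↦ (x a⁻¹) (a y)`. -/
def IsIsotopic (f : A → A) (a : A) : Prop :=
  a ≠ 0 ∧ ∀ x y, f (x * y) = f x * C.inv a * (a * f y)

namespace IsIsotopic

variable {C} {f g : A → A} {a b : A}

theorem map_triple (hf : C.IsIsotopic f a) (x y : A) : f (x * y * x) = f x * f y * f x := by
  rw [hf.2, hf.2, C.isotope_mul_mul_inv hf.1, C.isAlternative.middle_moufang,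
    C.inv_mul_cancel_right hf.1]

theorem of_map_mul (hf : ∀ x y, f (x * y) = f x * f y) : C.IsIsotopic f 1 :=
  have := C.nontrivial
  ⟨one_ne_zero, fun x y => by rw [hf, C.inv_eq_of_mul_eq_one (mul_one 1), mul_one, one_mul]⟩

theorem comp {γ : jordanAut A} (hγ : C.IsIsotopic γ a) (hg : C.IsIsotopic g b) :
    C.IsIsotopic (γ ∘ g) (a * γ b) := by
  refine ⟨fun h => ?_, fun x y => ?_⟩
  · exact (C.eq_zero_or_eq_zero_of_mul_eq_zero h).elim hγ.1 (jordanAut.map_ne_zero γ hg.1)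
  · simp only [Function.comp_apply]
    rw [hg.2, hγ.2, hγ.2, hγ.2, C.isotope_mul_mul_inv hγ.1, C.mul_isotope_mul hγ.1,
      C.map_inv γ hg.1, C.inv_mul_rev]

/-- Cancelling `γ`, the inverse satisfies `γ⁻¹ (x y) = γ⁻¹ (x a) γ⁻¹ (a⁻¹ y)`; the factors are
evaluated by setting `y = 1` and `x = 1`. -/
theorem inv {γ : jordanAut A} (hγ : C.IsIsotopic γ a) :
    C.IsIsotopic (γ⁻¹ : jordanAut A) (γ⁻¹ (C.inv a)) := by
  have ha := hγ.1
  have hγa : γ⁻¹ a ≠ 0 := jordanAut.map_ne_zero γ⁻¹ ha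
  have hmul (x y : A) : γ⁻¹ (x * y) = γ⁻¹ (x * a) * γ⁻¹ (C.inv a * y) := by
    apply jordanAut.injective γ
    rw [hγ.2, jordanAut.apply_inv_self, jordanAut.apply_inv_self, jordanAut.apply_inv_self,
      C.mul_inv_cancel_right ha, C.mul_inv_cancel_left ha]
  have hmap_mul (x : A) : γ⁻¹ (x * a) = γ⁻¹ x * γ⁻¹ a := by
    have h := hmul x 1
    rw [mul_one, mul_one, C.map_inv γ⁻¹ ha] at h
    rw [h, C.inv_mul_cancel_right hγa]
  have hmap_inv_mul (y : A) : γ⁻¹ (C.inv a * y) = γ⁻¹ (C.inv a) * γ⁻¹ y := by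
    have h := hmul 1 y
    rw [one_mul, one_mul] at h
    rw [h, C.map_inv γ⁻¹ ha, C.inv_mul_cancel_left hγa]
  refine ⟨jordanAut.map_ne_zero γ⁻¹ (C.inv_ne_zero ha), fun x y => ?_⟩
  rw [hmul, hmap_mul, hmap_inv_mul, C.map_inv γ⁻¹ ha, C.inv_inv]

theorem injective {f : A →+ A} (hf : C.IsIsotopic f a) (hone : f 1 = 1) :
    Function.Injective f := by
  have := C.nontrivial
  refine (injective_iff_map_eq_zero f).2 fun x hx => by_contra fun hx0 => one_ne_zero (α := A) ?_
  rw [← hone, ← C.mul_inv_cancel hx0, hf.2, hx, zero_mul, zero_mul]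

/-- A surjective isotopic map that fixes `1`, as a Jordan automorphism. -/
noncomputable def toJordanAut {f : A →+ A} (hf : C.IsIsotopic f a) (hone : f 1 = 1)
    (hsurj : Function.Surjective f) : jordanAut A :=
  ⟨Equiv.ofBijective f ⟨hf.injective hone, hsurj⟩, f.map_add, hone, hf.map_triple⟩

end IsIsotopic

/-- The group of the Jordan automorphisms that are isomorphisms of `A` onto one of its isotopes. -/
def isotopyGroup : Subgroup (jordanAut A) where
  carrier := {γ | ∃ a, C.IsIsotopic γ a}
  mul_mem' := fun ⟨_, hγ⟩ ⟨_, hδ⟩ => ⟨_, hγ.comp hδ⟩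
  one_mem' := ⟨1, .of_map_mul fun _ _ => rfl⟩
  inv_mem' := fun ⟨_, hγ⟩ => ⟨_, hγ.inv⟩

/-- Applied to `conjJordan`, isotopy reads `y x = (x a⁻¹) (a y)`; for `x = a` this shows that `a` is
central. -/
theorem conjJordan_notMem_isotopyGroup (hA : ∃ x y : A, ¬Commute x y) :
    C.conjJordan ∉ C.isotopyGroup := by
  rintro ⟨a, ha, h⟩
  have hswap (x y : A) : y * x = x * C.inv a * (a * y) := by
    simpa only [C.conjJordan_apply, σ.map_mul, σ.involutive] using h (σ x) (σ y)
  obtain ⟨k, rfl⟩ := C.exists_eq_smul_one_of_forall_commute hA fun x => (show x * a = a * x by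
    rw [hswap a x, C.mul_inv_cancel ha, one_mul]).symm
  obtain ⟨x, y, hxy⟩ := hA
  apply hxy
  rw [commute_iff_eq, hswap y x, C.smul_one_mul, C.mul_smul, ← C.smul_mul, ← C.mul_smul_one,
    C.inv_mul_cancel_right ha]

/-- Conjugation `x ↦ w⁻¹ x w`. -/
def conjugation (w : A) : A →ₗ[K] A where
  toFun x := C.inv w * x * w
  map_add' x y := by rw [mul_add, add_mul]
  map_smul' k x := by rw [C.mul_smul, C.smul_mul, RingHom.id_apply]

theorem conjugation_apply (w x : A) : C.conjugation w x = C.inv w * x * w := rfl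

theorem conjugation_one {w : A} (hw : w ≠ 0) : C.conjugation w 1 = 1 := by
  rw [conjugation_apply, mul_one, C.inv_mul_cancel hw]

theorem inv_mul_mul_self (w x : A) : C.inv w * x * w = C.inv w * (x * w) := by
  rw [inv, C.conj_eq, C.smul_mul, C.smul_mul, C.smul_mul, sub_mul, sub_mul, sub_mul,
    C.smul_one_mul, C.smul_one_mul, C.smul_mul, C.isAlternative.flexible]

theorem mul_conjugation {w : A} (hw : w ≠ 0) (x : A) : w * C.conjugation w x = x * w := by
  rw [conjugation_apply, C.inv_mul_mul_self, C.mul_inv_cancel_left hw]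

theorem mul_mul_inv_self (w x : A) : w * x * C.inv w = w * (x * C.inv w) := by
  simpa only [C.inv_inv] using C.inv_mul_mul_self (C.inv w) x

theorem conjugation_surjective {w : A} (hw : w ≠ 0) : Function.Surjective (C.conjugation w) :=
  fun x => ⟨w * x * C.inv w, by
    rw [conjugation_apply, C.mul_mul_inv_self, C.inv_mul_cancel_left hw, C.inv_mul_cancel_right hw]⟩

theorem inv_of_tr_eq_zero {v : A} (hv : C.tr v = 0) : C.inv v = -(C.nm v)⁻¹ • v := by
  rw [inv, C.conj_of_tr_eq_zero hv, smul_neg, neg_smul]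

theorem isIsotopic_conjugation {v : A} (hv : v ≠ 0) (htr : C.tr v = 0) :
    C.IsIsotopic (C.conjugation v) v := by
  refine ⟨hv, fun x y => ?_⟩
  rw [conjugation_apply, conjugation_apply, conjugation_apply, C.mul_inv_cancel_right hv,
    C.inv_mul_mul_self v y, C.mul_inv_cancel_left hv, C.inv_of_tr_eq_zero htr]
  simp only [C.smul_mul, C.isAlternative.middle_moufang]

theorem conj_conjugation {v : A} (hv : v ≠ 0) (htr : C.tr v = 0) (x : A) :
    σ (C.conjugation v x) = x - ((C.nm v)⁻¹ * C.polar x v) • v := by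
  have hnm : C.nm v ≠ 0 := mt C.nm_eq_zero.1 hv
  have hconj : v * σ x = C.polar x v • (1 : A) + x * v := by
    rw [C.polar_smul_one, C.conj_of_tr_eq_zero htr, mul_neg, neg_add_cancel_comm]
  have hmul : v * σ x * v = C.polar x v • v - C.nm v • x := by
    rw [hconj, add_mul, C.smul_one_mul, C.isAlternative.right, C.mul_self, htr, zero_smul, zero_sub,
      mul_neg, C.mul_smul_one, ← sub_eq_add_neg]
  rw [conjugation_apply, C.inv_mul_mul_self, C.inv_of_tr_eq_zero htr, C.smul_mul, σ.map_smul,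
    σ.map_mul, σ.map_mul, C.conj_of_tr_eq_zero htr, mul_neg, neg_mul, neg_mul, neg_neg, hmul,
    smul_sub, smul_smul, smul_smul, neg_mul, neg_mul, inv_mul_cancel₀ hnm, neg_smul, neg_smul,
    one_smul]
  abel

end CompositionDivisionAlgebra

namespace IsQuaternionDivisionAlgebra

variable {K : Type u} {A : Type v} [Field K] [NonUnitalNonAssocRing A] [Module K A]

theorem finrank_eq (h : IsQuaternionDivisionAlgebra K A) : Module.finrank K A = 4 := by
  obtain ⟨D, f, -⟩ := h
  rw [f.finrank_eq, D.finrank_alg]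

theorem finite (h : IsQuaternionDivisionAlgebra K A) : Module.Finite K A :=
  Module.finite_of_finrank_eq_succ h.finrank_eq

theorem mul_assoc (h : IsQuaternionDivisionAlgebra K A) (x y z : A) :
    x * y * z = x * (y * z) := by
  obtain ⟨D, f, hf⟩ := h
  exact f.injective (by simp only [hf, D.mul_assoc])

theorem exists_not_commute (h : IsQuaternionDivisionAlgebra K A) : ∃ x y : A, ¬Commute x y := by
  obtain ⟨D, f, hf⟩ := h
  obtain ⟨x, y, hxy⟩ := D.exists_not_commute
  refine ⟨f.symm x, f.symm y, fun h => hxy ?_⟩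
  simpa only [commute_iff_eq, hf, f.apply_symm_apply] using congrArg f h.eq

end IsQuaternionDivisionAlgebra

namespace CompositionDivisionAlgebra

variable {K : Type u} {A : Type v} [Field K] [NonAssocRing A] [Module K A] {σ : Involution K A}
  (C : CompositionDivisionAlgebra σ) {H : NonUnitalSubalgebra K A} {e w : A}
include C

theorem conj_mem (hone : (1 : A) ∈ H) {x : A} (hx : x ∈ H) : σ x ∈ H := by
  rw [C.conj_eq]
  exact sub_mem (SMulMemClass.smul_mem _ hone) hx

theorem inv_mem (hone : (1 : A) ∈ H) {x : A} (hx : x ∈ H) : C.inv x ∈ H :=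
  SMulMemClass.smul_mem _ (C.conj_mem hone hx)

theorem conj_inv (x : A) : σ (C.inv x) = (C.nm x)⁻¹ • x := by
  rw [inv, σ.map_smul, σ.involutive]

theorem conjugation_mem (hone : (1 : A) ∈ H) (hw : w ∈ H) {x : A} (hx : x ∈ H) :
    C.conjugation w x ∈ H :=
  mul_mem (mul_mem (C.inv_mem hone hw) hx) hw

/-- Left multiplication by `a` as a `K`-linear map. -/
def mulLeft (a : A) : A →ₗ[K] A where
  toFun x := a * x
  map_add' := mul_add a
  map_smul' k := C.mul_smul k a

/-- The map `(x, y) ↦ x + e y`. -/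
def addMulLeft (H : NonUnitalSubalgebra K A) (e : A) : H × H →ₗ[K] A :=
  H.toSubmodule.subtype.coprod (C.mulLeft e ∘ₗ H.toSubmodule.subtype)

theorem addMulLeft_apply (x y : H) : C.addMulLeft H e (x, y) = x + e * y := rfl

theorem exists_orthogonal (hH : IsQuaternionDivisionAlgebra K H) (hdim : Module.finrank K A = 8) :
    ∃ e : A, e ≠ 0 ∧ ∀ x ∈ H, C.polar e x = 0 := by
  have := Module.finite_of_finrank_eq_succ hdim
  have := hH.finite
  have hker : LinearMap.ker (C.polar.domRestrict₂ H.toSubmodule) ≠ ⊥ :=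
    LinearMap.ker_ne_bot_of_finrank_lt (by
      have h4 : Module.finrank K H.toSubmodule = 4 := hH.finrank_eq
      rw [Module.finrank_linearMap, h4, hdim, Module.finrank_self]
      norm_num)
  obtain ⟨e, he, hne⟩ := Submodule.exists_mem_ne_zero_of_ne_bot hker
  exact ⟨e, hne, fun x hx => LinearMap.congr_fun (LinearMap.mem_ker.1 he) ⟨x, hx⟩⟩

/-- A quaternion subalgebra `H` containing `1` together with a non-zero `e` orthogonal to `H`. Such
a pair presents an octonion algebra as the double `H ⊕ e H`. -/
structure IsCayleyDicksonPair (H : NonUnitalSubalgebra K A) (e : A) : Prop where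
  one_mem : (1 : A) ∈ H
  quaternion : IsQuaternionDivisionAlgebra K H
  ne_zero : e ≠ 0
  polar_eq_zero : ∀ x ∈ H, C.polar e x = 0

namespace IsCayleyDicksonPair

variable {C} (h : C.IsCayleyDicksonPair H e)
include h

theorem tr_eq_zero : C.tr e = 0 := by
  rw [← C.polar_one_right, h.polar_eq_zero 1 h.one_mem]

theorem mul_assoc {x y z : A} (hx : x ∈ H) (hy : y ∈ H) (hz : z ∈ H) :
    x * y * z = x * (y * z) :=
  congrArg Subtype.val (h.quaternion.mul_assoc ⟨x, hx⟩ ⟨y, hy⟩ ⟨z, hz⟩)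

theorem conj_mem {x : A} (hx : x ∈ H) : σ x ∈ H := C.conj_mem h.one_mem hx

theorem inv_mem {x : A} (hx : x ∈ H) : C.inv x ∈ H := C.inv_mem h.one_mem hx

theorem add_mul_add {x y p q : A} (hx : x ∈ H) (hy : y ∈ H) (hp : p ∈ H) (hq : q ∈ H) :
    (x + e * y) * (p + e * q) = x * p - C.nm e • (q * σ y) + e * (σ x * q + p * y) :=
  have horth := h.polar_eq_zero
  C.add_orth_mul_add_orth h.tr_eq_zero (horth x hx) (horth y hy) (horth p hp) (horth q hq)
    (horth _ (mul_mem hp hy)) (horth _ (mul_mem hy (h.conj_mem hq)))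

/-- If `e` lay in `H`, all of `e H = H` would be orthogonal to `1`; then `σ` would be the identity
on `H`, and `H` would be commutative. -/
theorem notMem : e ∉ H := by
  intro he
  have htr (x : A) (hx : x ∈ H) : C.tr x = 0 :=
    C.tr_eq_zero_of_polar_mul_eq_zero h.ne_zero (h.polar_eq_zero _ (mul_mem he hx))
  have hconj (x : A) (hx : x ∈ H) : σ x = x :=
    C.conj_eq_self_of_tr_eq_zero (htr 1 h.one_mem) (htr x hx)
  obtain ⟨x, y, hxy⟩ := h.quaternion.exists_not_commute
  refine hxy (Subtype.ext ?_)
  change (x : A) * y = y * x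
  rw [← hconj _ (mul_mem x.2 y.2), σ.map_mul, hconj _ x.2, hconj _ y.2]

theorem addMulLeft_injective : Function.Injective (C.addMulLeft H e) := by
  refine (injective_iff_map_eq_zero _).2 fun ⟨x, y⟩ hxy => ?_
  rw [C.addMulLeft_apply] at hxy
  have hy : (y : A) = 0 := by
    by_contra hy
    refine h.notMem ?_
    rw [← C.mul_inv_cancel_right hy e, eq_neg_of_add_eq_zero_right hxy]
    exact mul_mem (neg_mem x.2) (h.inv_mem y.2)
  rw [hy, mul_zero, add_zero] at hxy
  exact Prod.ext (Subtype.ext hxy) (Subtype.ext hy)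

variable (hdim : Module.finrank K A = 8)

/-- The decomposition `A = H ⊕ e H`. -/
noncomputable def sumEquiv : (H × H) ≃ₗ[K] A :=
  have := Module.finite_of_finrank_eq_succ hdim
  have := h.quaternion.finite
  (C.addMulLeft H e).linearEquivOfInjective h.addMulLeft_injective
    (by rw [Module.finrank_prod, h.quaternion.finrank_eq, hdim])

theorem sumEquiv_apply (x y : H) : h.sumEquiv hdim (x, y) = x + e * y := rfl

include hdim in
theorem exists_eq_add_mul (z : A) : ∃ x ∈ H, ∃ y ∈ H, z = x + e * y := by
  obtain ⟨⟨x, y⟩, rfl⟩ := (h.sumEquiv hdim).surjective z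
  exact ⟨x, x.2, y, y.2, rfl⟩

/-- The map `ψ_(H, e, w) : x + e y ↦ x + e (w⁻¹ y w)`. -/
noncomputable def psi (w : A) : A →ₗ[K] A :=
  H.toSubmodule.subtype.coprod (C.mulLeft e ∘ₗ C.conjugation w ∘ₗ H.toSubmodule.subtype) ∘ₗ
    (h.sumEquiv hdim).symm.toLinearMap

theorem psi_apply (w : A) {x y : A} (hx : x ∈ H) (hy : y ∈ H) :
    h.psi hdim w (x + e * y) = x + e * C.conjugation w y := by
  have hz : (h.sumEquiv hdim).symm (x + e * y) = (⟨x, hx⟩, ⟨y, hy⟩) := by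
    rw [LinearEquiv.symm_apply_eq, sumEquiv_apply]
  simp only [psi, LinearMap.comp_apply, LinearEquiv.coe_coe, hz]
  rfl

theorem psi_one (w : A) : h.psi hdim w 1 = 1 := by
  simpa only [map_zero, mul_zero, add_zero] using h.psi_apply hdim w h.one_mem H.zero_mem

variable (hw : w ∈ H) (hw0 : w ≠ 0)
include hw hw0

theorem add_mul_conjugation_mul (x : A) {y : A} (hy : y ∈ H) :
    (x + e * C.conjugation w y) * w = x * w + e * (y * w) := by
  have hcy := C.conjugation_mem h.one_mem hw hy
  rw [add_mul, C.orth_mul h.tr_eq_zero (h.polar_eq_zero _ hcy) (h.polar_eq_zero _ hw)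
    (h.polar_eq_zero _ (mul_mem hw hcy)), C.mul_conjugation hw0]

theorem inv_mul_add_mul_conjugation (p q : A) :
    C.inv w * (p + e * C.conjugation w q) = C.inv w * p + e * ((C.nm w)⁻¹ • (q * w)) := by
  rw [mul_add, C.mul_orth h.tr_eq_zero (h.polar_eq_zero _ (h.inv_mem hw)), C.conj_inv, C.smul_mul,
    C.mul_conjugation hw0]

theorem isIsotopic_psi : C.IsIsotopic (h.psi hdim w) (C.inv w) := by
  refine ⟨C.inv_ne_zero hw0, fun z t => ?_⟩
  obtain ⟨x, hx, y, hy, rfl⟩ := h.exists_eq_add_mul hdim z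
  obtain ⟨p, hp, q, hq, rfl⟩ := h.exists_eq_add_mul hdim t
  have hw' := h.inv_mem hw
  have hcx := h.conj_mem hx
  have hcy := h.conj_mem hy
  have hxp : x * w * (C.inv w * p) = x * p := by
    rw [h.mul_assoc hx hw (mul_mem hw' hp), C.mul_inv_cancel_left hw0]
  have hqy : (C.nm w)⁻¹ • (q * w) * σ (y * w) = q * σ y := by
    rw [C.smul_mul, σ.map_mul, h.mul_assoc hq hw (mul_mem (h.conj_mem hw) hcy),
      C.mul_conj_mul_cancel, C.mul_smul, inv_smul_smul₀ (mt C.nm_eq_zero.1 hw0)]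
  have hxq : σ (x * w) * ((C.nm w)⁻¹ • (q * w)) = C.conjugation w (σ x * q) := by
    rw [C.mul_smul, ← C.smul_mul, σ.map_mul, ← C.smul_mul, ← inv, C.conjugation_apply,
      h.mul_assoc hw' hcx (mul_mem hq hw), ← h.mul_assoc hcx hq hw,
      h.mul_assoc hw' (mul_mem hcx hq) hw]
  have hpy : C.inv w * p * (y * w) = C.conjugation w (p * y) := by
    rw [C.conjugation_apply, h.mul_assoc hw' (mul_mem hp hy) hw, h.mul_assoc hp hy hw,
      h.mul_assoc hw' hp (mul_mem hy hw)]
  rw [h.add_mul_add hx hy hp hq, h.psi_apply hdim w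
      (sub_mem (mul_mem hx hp) (SMulMemClass.smul_mem _ (mul_mem hq hcy)))
      (add_mem (mul_mem hcx hq) (mul_mem hp hy)),
    h.psi_apply hdim w hx hy, h.psi_apply hdim w hp hq, C.inv_inv,
    h.add_mul_conjugation_mul hw hw0 x hy, h.inv_mul_add_mul_conjugation hw hw0 p q,
    h.add_mul_add (mul_mem hx hw) (mul_mem hy hw) (mul_mem hw' hp)
      (SMulMemClass.smul_mem _ (mul_mem hq hw)), hxp, hqy, hxq, hpy, map_add]

/-- The map `ψ_(H, e, w)` as a Jordan automorphism. -/
noncomputable def psiAut : jordanAut A :=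
  (h.isIsotopic_psi hdim hw hw0).toJordanAut (f := (h.psi hdim w).toAddMonoidHom)
    (h.psi_one hdim w) (by
      have := Module.finite_of_finrank_eq_succ hdim
      exact LinearMap.injective_iff_surjective.1
        ((h.isIsotopic_psi hdim hw hw0).injective (f := (h.psi hdim w).toAddMonoidHom)
          (h.psi_one hdim w)))

end IsCayleyDicksonPair

end CompositionDivisionAlgebra

/-- The homomorphism `x + e y ↦ ι x + y₀ ι y` from the double `(B, -N(y₀))` of an algebra `B` with
involution, for an involution-preserving `ι : B → A` and `y₀` orthogonal to its image. -/
def Doubling.ofOrthogonal {K A B : Type*} [Field K] [NonAssocRing A] [Module K A]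
    [NonAssocRing B] [Module K B] {σ : Involution K A} {τ : Involution K B}
    (C : CompositionDivisionAlgebra σ) (ι : B →ₙₐ[K] A) (hconj : ∀ x, ι (τ x) = σ (ι x)) {y₀ : A}
    (htr : C.tr y₀ = 0) (horth : ∀ x, C.polar y₀ (ι x) = 0) :
    Doubling τ (-C.nm y₀) →ₙₐ[K] A where
  toFun z := ι z.fst + y₀ * ι z.snd
  map_zero' := by simp only [fst_zero, snd_zero, map_zero, mul_zero, add_zero]
  map_add' z t := by
    simp only [fst_add, snd_add, map_add, mul_add]
    abel
  map_smul' k z := by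
    simp only [fst_smul, snd_smul, map_smul, C.mul_smul, smul_add, MonoidHom.id_apply]
  map_mul' z t := by
    have hpy : C.polar y₀ (ι t.fst * ι z.snd) = 0 := by rw [← map_mul, horth]
    have hyq : C.polar y₀ (ι z.snd * σ (ι t.snd)) = 0 := by rw [← hconj, ← map_mul, horth]
    rw [C.add_orth_mul_add_orth htr (horth _) (horth _) (horth _) (horth _) hpy hyq, fst_mul,
      snd_mul, sub_eq_add_neg, ← neg_smul]
    simp only [map_add, map_mul, map_smul, ← hconj]

namespace QuaternionData

variable {K : Type u} {A : Type v} [Field K] {D : QuaternionData.{u, v} K}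

theorem isQuaternionDivisionAlgebra_range [NonUnitalNonAssocRing A] [Module K A]
    (g : D.Alg →ₙₐ[K] A) (hg : Function.Injective g) :
    IsQuaternionDivisionAlgebra K (NonUnitalAlgHom.range g) := by
  let r := NonUnitalAlgHom.rangeRestrict g
  let f : D.Alg ≃ₗ[K] NonUnitalAlgHom.range g :=
    LinearEquiv.ofBijective (r : D.Alg →ₗ[K] NonUnitalAlgHom.range g)
      ⟨fun _ _ h => hg (congrArg Subtype.val h), fun ⟨_, x, hx⟩ => ⟨x, Subtype.ext hx⟩⟩
  have hf (x y : D.Alg) : f (x * y) = f x * f y := map_mul r x y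
  refine ⟨D, f.symm, fun x y => f.injective ?_⟩
  rw [hf, f.apply_symm_apply, f.apply_symm_apply, f.apply_symm_apply]

section Embedding

variable [NonAssocRing A] [Module K A] {σ : Involution K A} (C : CompositionDivisionAlgebra σ)
  (ι : D.E →ₙₐ[K] A) {y : A} (hone : ι 1 = 1) (hconj : ∀ x, ι (D.σ x) = σ (ι x)) (hy : y ≠ 0)
  (horth : ∀ x, C.polar y (ι x) = 0)
include hone hconj hy horth

theorem notMem_range_of_polar_eq_zero (x : D.E) : y ≠ ι x := by
  rintro rfl
  have := C.nontrivial
  have htr (z : D.E) : C.tr (ι z) = 0 :=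
    C.tr_eq_zero_of_polar_mul_eq_zero hy (by rw [← map_mul, horth])
  have hι := D.fieldComposition.injective_of_map_one_ne_zero ι (hone ▸ one_ne_zero)
  obtain ⟨z, hz⟩ := D.σ_nontrivial
  exact hz (hι (by rw [hconj, C.conj_eq_self_of_tr_eq_zero (hone ▸ htr 1) (htr z)]))

theorem not_isNormValue_neg_nm : ¬D.σ.IsNormValue (-C.nm y) := by
  rintro ⟨x, hx⟩
  have hn : C.nm (ι x) = -C.nm y := C.nm_eq_of_mul_conj (by
    rw [← hconj, ← map_mul, hx, map_smul, hone])
  have hyx : y + ι x = 0 := C.nm_eq_zero.1 (by rw [C.nm_add, hn, horth]; ring)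
  refine notMem_range_of_polar_eq_zero C ι hone hconj hy horth (-x) ?_
  rw [map_neg, eq_neg_of_add_eq_zero_left hyx]

/-- The quaternion division algebra `(E, -N(y))`, isomorphic to `E ⊕ y E`. -/
abbrev ofOrthogonal : QuaternionData.{u, v} K :=
  { D with
    b := -C.nm y
    b_ne_zero := neg_ne_zero.2 (mt C.nm_eq_zero.1 hy)
    b_not_norm := not_isNormValue_neg_nm C ι hone hconj hy horth }

theorem exists_quaternion_subalgebra : ∃ H : NonUnitalSubalgebra K A,
    IsQuaternionDivisionAlgebra K H ∧ ∀ x z : D.E, ι x + y * ι z ∈ H := by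
  have := C.nontrivial
  let D' := ofOrthogonal C ι hone hconj hy horth
  have htr : C.tr y = 0 := by rw [← C.polar_one_right, ← hone, horth]
  let g : D'.Alg →ₙₐ[K] A := Doubling.ofOrthogonal C ι hconj htr horth
  have hg : g 1 = 1 := by
    change ι 1 + y * ι 0 = 1
    rw [hone, map_zero, mul_zero, add_zero]
  refine ⟨NonUnitalAlgHom.range g, isQuaternionDivisionAlgebra_range g
    (D'.composition.injective_of_map_one_ne_zero g (hg ▸ one_ne_zero)), fun x z => ?_⟩
  exact ⟨Doubling.mk x z, rfl⟩

end Embedding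

end QuaternionData

namespace OctonionDivisionAlgebra

variable {K : Type u} {O : Type v} [Field K] [NonAssocRing O] [Module K O]
  (P : OctonionDivisionAlgebra K O)

/-- The embedding of the quadratic field `E` from which `O` is built by doubling twice. -/
def ofField : P.H.E →ₙₐ[K] O where
  toFun x := P.equiv.symm (Doubling.mk (Doubling.mk x 0) 0)
  map_zero' := by
    rw [LinearEquiv.symm_apply_eq, map_zero]
    rfl
  map_add' x y := P.equiv.injective (by
    simp only [map_add, P.equiv.apply_symm_apply]
    exact Doubling.ext (Doubling.ext (by simp) (by simp)) (by simp))
  map_smul' k x := P.equiv.injective (by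
    simp only [map_smul, P.equiv.apply_symm_apply, MonoidHom.id_apply]
    exact Doubling.ext (Doubling.ext (by simp) (by simp)) (by simp))
  map_mul' x y := P.equiv.injective (by
    simp only [P.map_mul, P.equiv.apply_symm_apply]
    exact Doubling.ext (Doubling.ext (by simp [Involution.map_zero])
      (by simp [Involution.map_zero])) (by simp))

theorem equiv_ofField (x : P.H.E) : P.equiv (P.ofField x) = Doubling.mk (Doubling.mk x 0) 0 :=
  P.equiv.apply_symm_apply _

theorem equiv_one : P.equiv 1 = 1 := by
  rw [← mul_one (P.equiv 1), ← P.equiv.apply_symm_apply (1 : Doubling P.H.conj P.c),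
    ← P.map_mul, one_mul]

theorem ofField_one : P.ofField 1 = 1 :=
  P.equiv.injective (by rw [P.equiv_ofField, P.equiv_one]; rfl)

theorem ofField_conj (x : P.H.E) : P.ofField (P.H.σ x) = P.conjInvolution (P.ofField x) :=
  P.equiv.injective ((P.equiv_ofField _).trans (by
    refine Eq.trans ?_ (P.equiv_conj (P.ofField x)).symm
    rw [P.equiv_ofField]
    exact Doubling.ext (Doubling.ext (by simp) (by simp)) (by simp)))

/-- The component of an octonion in the quadratic field `E`. -/
def fieldPart (x : O) : P.H.E := (P.equiv x).fst.fst

theorem polar_ofField {y : O} (hy : P.fieldPart y = 0) (x : P.H.E) :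
    P.composition.polar y (P.ofField x) = 0 := by
  refine P.composition.smul_one_injective ?_
  simp only [← P.bilin_eq, zero_smul]
  apply P.equiv.injective
  rw [fieldPart] at hy
  rw [bilin, map_add, P.map_mul, P.map_mul, P.equiv_conj, P.equiv_conj, P.equiv_ofField, map_zero]
  refine Doubling.ext (Doubling.ext ?_ ?_) ?_ <;> simp [Involution.map_zero, hy]

theorem exists_quaternion_subalgebra {y : O} (hy : P.fieldPart y = 0) (hy0 : y ≠ 0) :
    ∃ H : NonUnitalSubalgebra K O,
      IsQuaternionDivisionAlgebra K H ∧ ∀ x z : P.H.E, P.ofField x + y * P.ofField z ∈ H :=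
  QuaternionData.exists_quaternion_subalgebra P.composition P.ofField P.ofField_one P.ofField_conj
    hy0 (P.polar_ofField hy)

theorem exists_ne_zero_fieldPart_eq_zero : ∃ y : O, y ≠ 0 ∧ P.fieldPart y = 0 := by
  refine ⟨P.equiv.symm (Doubling.mk 0 1), fun h => ?_, ?_⟩
  · simpa using congrArg (fun z => z.snd.fst) ((LinearEquiv.symm_apply_eq _).1 h)
  · rw [fieldPart, P.equiv.apply_symm_apply, Doubling.fst_mk, Doubling.fst_zero]

theorem exists_eq_ofField_add (a : O) :
    ∃ (x z : P.H.E) (y : O), y ≠ 0 ∧ P.fieldPart y = 0 ∧ a = P.ofField x + y * P.ofField z := by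
  by_cases ha : a = P.ofField (P.fieldPart a)
  · obtain ⟨y, hy0, hy⟩ := P.exists_ne_zero_fieldPart_eq_zero
    exact ⟨P.fieldPart a, 0, y, hy0, hy, by rw [map_zero, mul_zero, add_zero, ← ha]⟩
  · refine ⟨P.fieldPart a, 1, a - P.ofField (P.fieldPart a), sub_ne_zero.2 ha, ?_, ?_⟩
    · rw [fieldPart, map_sub, P.equiv_ofField]
      exact sub_self _
    · rw [P.ofField_one, mul_one, add_sub_cancel]

theorem exists_quaternion_subalgebra_mem (P : OctonionDivisionAlgebra K O) (a : O) :
    ∃ H : NonUnitalSubalgebra K O, (1 : O) ∈ H ∧ IsQuaternionDivisionAlgebra K H ∧ a ∈ H := by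
  obtain ⟨x, z, y, hy0, hy, rfl⟩ := P.exists_eq_ofField_add a
  obtain ⟨H, hH, hmem⟩ := P.exists_quaternion_subalgebra hy hy0
  refine ⟨H, ?_, hH, hmem x z⟩
  simpa only [map_zero, mul_zero, add_zero, P.ofField_one] using hmem 1 0

end OctonionDivisionAlgebra

namespace IsQuaternionDivisionAlgebra

variable {K : Type u} {A : Type v} [Field K] [NonUnitalNonAssocRing A] [Module K A]

theorem exists_span_eq_top (h : IsQuaternionDivisionAlgebra K A) {o : A} (ho : ∀ x, o * x = x) :
    ∃ u j : A, Submodule.span K {o, u, j, j * u} = ⊤ := by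
  obtain ⟨D, f, hf⟩ := h
  have hone : f o = 1 := by
    rw [← mul_one (f o), ← f.apply_symm_apply 1, ← hf, ho]
  obtain ⟨t, ht⟩ := D.σ_nontrivial
  have ht' (k : K) : t ≠ k • 1 := by
    rintro rfl
    exact ht (by rw [D.σ.map_smul, D.σ.map_one])
  refine ⟨f.symm (Doubling.mk t 0), f.symm (Doubling.mk 0 1), eq_top_iff.2 fun x _ => ?_⟩
  obtain ⟨a, b, hab⟩ := D.exists_eq_smul_one_add_smul ht' (f x).fst
  obtain ⟨c, d, hcd⟩ := D.exists_eq_smul_one_add_smul ht' (f x).snd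
  simp only [Submodule.mem_span_insert, Submodule.mem_span_singleton]
  refine ⟨a, _, ⟨b, _, ⟨c, _, ⟨d, rfl⟩, rfl⟩, rfl⟩, f.injective ?_⟩
  simp only [map_add, map_smul, hf, hone, f.apply_symm_apply]
  exact Doubling.ext (by simp [← hab]) (by simp [← hcd, Involution.map_zero])

theorem exists_span_eq_toSubmodule {B : Type v} [NonAssocRing B] [Module K B]
    {H : NonUnitalSubalgebra K B} (h : IsQuaternionDivisionAlgebra K H) (hone : (1 : B) ∈ H) :
    ∃ u j : B, Submodule.span K {1, u, j, j * u} = H.toSubmodule := by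
  obtain ⟨u, j, hspan⟩ := h.exists_span_eq_top (o := ⟨1, hone⟩) fun x => Subtype.ext (one_mul _)
  refine ⟨u, j, ?_⟩
  have hmap := congrArg (Submodule.map H.toSubmodule.subtype) hspan
  simp only [Submodule.map_top, Submodule.range_subtype, Submodule.map_span, Set.image_insert_eq,
    Set.image_singleton] at hmap
  exact hmap

end IsQuaternionDivisionAlgebra

namespace CompositionDivisionAlgebra

variable {K A : Type*} [Field K] [NonAssocRing A] [Module K A] {σ : Involution K A}
  (C : CompositionDivisionAlgebra σ)

/-- The group generated by the standard involution and the isotopies. -/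
def generated : Subgroup (jordanAut A) :=
  Subgroup.closure ({C.conjJordan} ∪ C.isotopyGroup)

theorem conjJordan_mem_generated : C.conjJordan ∈ C.generated :=
  Subgroup.subset_closure (Or.inl rfl)

theorem isotopyGroup_le_generated : C.isotopyGroup ≤ C.generated :=
  fun _ h => Subgroup.subset_closure (Or.inr h)

theorem exists_generated_reflection {v : A} (hv : v ≠ 0) (htr : C.tr v = 0) :
    ∃ δ ∈ C.generated, ∀ x, δ x = x - ((C.nm v)⁻¹ * C.polar x v) • v := by
  let c := (C.isIsotopic_conjugation hv htr).toJordanAut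
    (f := (C.conjugation v).toAddMonoidHom) (C.conjugation_one hv) (C.conjugation_surjective hv)
  exact ⟨C.conjJordan * c, mul_mem C.conjJordan_mem_generated
    (C.isotopyGroup_le_generated ⟨v, C.isIsotopic_conjugation hv htr⟩), C.conj_conjugation hv htr⟩

/-- The reflection in `p - q` maps `p` to `q`. -/
theorem exists_generated_map_eq {p q : A} (hnm : C.nm p = C.nm q) (htr : C.tr p = C.tr q) :
    ∃ δ ∈ C.generated, δ p = q ∧ ∀ y, C.polar p y = C.polar q y → δ y = y := by
  rcases eq_or_ne p q with rfl | hpq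
  · exact ⟨1, one_mem _, rfl, fun _ _ => rfl⟩
  · have hv : p - q ≠ 0 := sub_ne_zero.2 hpq
    obtain ⟨δ, hδ, h⟩ := C.exists_generated_reflection hv (by rw [map_sub, htr, sub_self])
    refine ⟨δ, hδ, ?_, fun y hy => ?_⟩
    · have hp : C.polar p (p - q) = C.nm (p - q) := by
        rw [sub_eq_add_neg, C.nm_add, ← neg_one_smul K q, map_add, map_smul, C.polar_self,
          C.nm_smul, hnm]
        ring
      rw [h, hp, inv_mul_cancel₀ (mt C.nm_eq_zero.1 hv), one_smul, sub_sub_cancel]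
    · rw [h, map_sub, C.polar_comm y p, C.polar_comm y q, hy, sub_self, mul_zero, zero_smul,
        sub_zero]

variable (hA : ∃ x y : A, ¬Commute x y) (γ : jordanAut A)
include C hA

theorem exists_generated_map_mul (a b : A) :
    ∃ δ ∈ C.generated, δ (γ (a * b)) = γ a * γ b ∧
      (∀ c, γ (a * c) = γ a * γ c → δ (γ (a * c)) = γ a * γ c) ∧
      ∀ y, γ (y * σ b) = γ y * γ (σ b) → δ (γ y) = γ y := by
  have hpolar (y : A) (hy : γ (y * σ b) = γ y * γ (σ b)) :
      C.polar (γ (a * b)) (γ y) = C.polar (γ a * γ b) (γ y) := by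
    rw [C.polar_mul_eq_polar_mul_conj (γ a), ← C.map_conj γ hA, ← hy, C.polar_map γ hA,
      C.polar_map γ hA, C.polar_mul_eq_polar_mul_conj]
  have hnm : C.nm (γ (a * b)) = C.nm (γ a * γ b) := by
    rw [C.nm_mul, C.nm_map γ hA, C.nm_map γ hA, C.nm_map γ hA, C.nm_mul, map_mul]
  have htr : C.tr (γ (a * b)) = C.tr (γ a * γ b) := by
    simpa only [map_one, C.polar_one_right] using hpolar 1 (by rw [one_mul, map_one, one_mul])
  obtain ⟨δ, hδ, hmap, hfix⟩ := C.exists_generated_map_eq hnm htr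
  refine ⟨δ, hδ, hmap, fun c hc => ?_, fun y hy => hfix _ (hpolar y hy)⟩
  rw [← hc]
  refine hfix _ ?_
  rw [C.polar_map γ hA, hc, C.polar_mul_mul_left, C.polar_mul_mul_left, C.polar_map γ hA,
    C.nm_map γ hA, map_mul]

theorem exists_generated_map_mul_eq_mul (j u : A) :
    ∃ δ ∈ C.generated, (δ * γ) (j * u) = (δ * γ) j * (δ * γ) u := by
  obtain ⟨δ, hδ, hju, hleft, hright⟩ := C.exists_generated_map_mul hA γ j u
  have hj : δ (γ j) = γ j := by
    simpa only [mul_one, map_one] using hleft 1 (by rw [mul_one, map_one, mul_one])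
  have hu : δ (γ u) = γ u := hright u (by
    rw [C.map_conj γ hA, C.mul_conj, C.mul_conj, C.map_smul_one_eq_scalarHom γ hA, C.nm_map γ hA])
  exact ⟨δ, hδ, by simp only [jordanAut.mul_apply, hju, hj, hu]⟩

theorem map_mul_of_mem_span {S : Set A} {x y : A} (hS : ∀ z ∈ S, γ (x * z) = γ x * γ z)
    (hy : y ∈ Submodule.span K S) : γ (x * y) = γ x * γ y := by
  induction hy using Submodule.span_induction with
  | mem z hz => exact hS z hz
  | zero => rw [mul_zero, map_zero, mul_zero]
  | add z t _ _ hz ht => rw [mul_add, map_add, map_add, hz, ht, mul_add]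
  | smul k z _ hz =>
    rw [C.mul_smul, C.map_smul γ hA, C.map_smul γ hA, hz, C.mul_smul]

theorem map_mul_of_mem_span₂ {S : Set A} {x y : A}
    (hS : ∀ z ∈ S, ∀ t ∈ S, γ (z * t) = γ z * γ t) (hx : x ∈ Submodule.span K S)
    (hy : y ∈ Submodule.span K S) : γ (x * y) = γ x * γ y :=
  C.map_mul_of_mem_span hA γ (fun z hz =>
    jordanAut.map_mul_swap γ (C.map_mul_of_mem_span hA γ (hS z hz) hx)) hy

theorem map_mul_of_mem_span_mul {u j x y : A} (h : γ (j * u) = γ j * γ u)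
    (hx : x ∈ Submodule.span K {1, u, j, j * u}) (hy : y ∈ Submodule.span K {1, u, j, j * u}) :
    γ (x * y) = γ x * γ y := by
  have halt := C.isAlternative
  have hj : γ (j * (j * u)) = γ j * γ (j * u) := by
    rw [halt.left, h, halt.left, ← jordanAut.map_mul_self, C.mul_self, sub_mul,
      C.smul_mul, C.smul_one_mul, map_sub, map_sub, sub_mul, C.map_smul γ hA, C.map_smul γ hA,
      C.map_smul γ hA, C.map_smul_one_eq_scalarHom γ hA, C.smul_mul, C.smul_one_mul, h]
  have hu : γ (u * (j * u)) = γ u * γ (j * u) := by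
    rw [← halt.flexible, jordanAut.map_triple, h, halt.flexible]
  refine C.map_mul_of_mem_span₂ hA γ (fun x hx y hy => ?_) hx hy
  simp only [Set.mem_insert_iff, Set.mem_singleton_iff] at hx hy
  rcases hx with rfl | rfl | rfl | rfl <;> rcases hy with rfl | rfl | rfl | rfl <;>
  first
  | simp only [one_mul, mul_one, map_one]
  | exact jordanAut.map_mul_self _ _
  | assumption
  | (apply jordanAut.map_mul_swap; assumption)

section Extension

variable {H : NonUnitalSubalgebra K A} (hone : (1 : A) ∈ H)
  (hγ : ∀ x ∈ H, ∀ y ∈ H, γ (x * y) = γ x * γ y)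
include hone hγ

theorem exists_generated_map_mul_of_finset (e : A) (S : Finset A) (hS : ∀ x ∈ S, x ∈ H) :
    ∃ δ ∈ C.generated, (∀ x ∈ H, δ (γ x) = γ x) ∧ δ (γ e) = γ e ∧
      ∀ x ∈ S, δ (γ (e * x)) = γ e * γ x := by
  classical
  induction S using Finset.induction_on with
  | empty => exact ⟨1, one_mem _, fun _ _ => rfl, rfl, fun _ h => absurd h (Finset.notMem_empty _)⟩
  | insert x S _ ih =>
    simp only [Finset.forall_mem_insert] at hS ⊢
    obtain ⟨δ, hδ, hH, he, hmul⟩ := ih hS.2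
    obtain ⟨ε, hε, hx, hleft, hright⟩ := C.exists_generated_map_mul hA (δ * γ) e x
    simp only [jordanAut.mul_apply, he, hH x hS.1] at hx hleft hright
    have hεH (y : A) (hy : y ∈ H) : ε (δ (γ y)) = γ y := by
      have hx' := C.conj_mem hone hS.1
      rw [hright y (by rw [hH _ (mul_mem hy hx'), hH y hy, hH _ hx', hγ y hy _ hx']), hH y hy]
    refine ⟨ε * δ, mul_mem hε hδ, hεH, ?_, hx, fun y hy => ?_⟩
    · have h := hleft 1
      simp only [mul_one, map_one, he] at h
      rw [jordanAut.mul_apply, he, h trivial]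
    · have h := hleft y
      rw [hH y (hS.2 y hy)] at h
      exact h (hmul y hy)

theorem exists_generated_map_mul_of_span_eq (e : A) {S : Finset A}
    (hS : Submodule.span K S = H.toSubmodule) :
    ∃ δ ∈ C.generated, (∀ x ∈ H, (δ * γ) x = γ x) ∧
      ∀ x ∈ H, (δ * γ) (e * x) = (δ * γ) e * (δ * γ) x := by
  have hSH (x : A) (hx : x ∈ S) : x ∈ H :=
    hS.le (Submodule.subset_span hx)
  obtain ⟨δ, hδ, hH, he, hmul⟩ := C.exists_generated_map_mul_of_finset hA γ hone hγ e S hSH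
  refine ⟨δ, hδ, hH, fun x hx => C.map_mul_of_mem_span hA (δ * γ) (fun z hz => ?_)
    (hS.ge hx)⟩
  rw [jordanAut.mul_apply, jordanAut.mul_apply, jordanAut.mul_apply, hmul z hz, he, hH z (hSH z hz)]

end Extension

end CompositionDivisionAlgebra

namespace CompositionDivisionAlgebra.IsCayleyDicksonPair

variable {K : Type u} {A : Type v} [Field K] [NonAssocRing A] [Module K A] {σ : Involution K A}
  {C : CompositionDivisionAlgebra σ} {H : NonUnitalSubalgebra K A} {e : A}
  (h : C.IsCayleyDicksonPair H e) (hdim : Module.finrank K A = 8)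
  (hA : ∃ x y : A, ¬Commute x y)
include h hdim hA

theorem map_mul_of_map_mul (γ : jordanAut A) (hγ : ∀ x ∈ H, ∀ y ∈ H, γ (x * y) = γ x * γ y)
    (hγe : ∀ x ∈ H, γ (e * x) = γ e * γ x) (z t : A) : γ (z * t) = γ z * γ t := by
  obtain ⟨x, hx, y, hy, rfl⟩ := h.exists_eq_add_mul hdim z
  obtain ⟨p, hp, q, hq, rfl⟩ := h.exists_eq_add_mul hdim t
  have hx' := h.conj_mem hx
  have hy' := h.conj_mem hy
  have hq' := h.conj_mem hq
  have htr : C.tr (γ e) = 0 := by rw [C.tr_map γ hA, h.tr_eq_zero, map_zero]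
  have horth (x : A) (hx : x ∈ H) : C.polar (γ e) (γ x) = 0 := by
    rw [C.polar_map γ hA, h.polar_eq_zero x hx, map_zero]
  have hpy : C.polar (γ e) (γ p * γ y) = 0 := by
    rw [← hγ p hp y hy, horth _ (mul_mem hp hy)]
  have hyq : C.polar (γ e) (γ y * σ (γ q)) = 0 := by
    rw [← C.map_conj γ hA, ← hγ y hy _ hq', horth _ (mul_mem hy hq')]
  rw [h.add_mul_add hx hy hp hq, map_add, map_sub, map_add, map_add, hγe y hy, hγe q hq,
    C.add_orth_mul_add_orth htr (horth x hx) (horth y hy) (horth p hp) (horth q hq) hpy hyq,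
    hγe _ (add_mem (mul_mem hx' hq) (mul_mem hp hy)), C.map_smul γ hA, C.nm_map γ hA, map_add,
    hγ x hx p hp, hγ q hq _ hy', hγ _ hx' q hq, hγ p hp y hy, C.map_conj γ hA, C.map_conj γ hA]

theorem generated_eq_top : C.generated = ⊤ := by
  classical
  refine eq_top_iff.2 fun γ _ => ?_
  obtain ⟨u, j, hspan⟩ := h.quaternion.exists_span_eq_toSubmodule h.one_mem
  obtain ⟨δ, hδ, hju⟩ := C.exists_generated_map_mul_eq_mul hA γ j u
  have hmul (x : A) (hx : x ∈ H) (y : A) (hy : y ∈ H) :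
      (δ * γ) (x * y) = (δ * γ) x * (δ * γ) y :=
    C.map_mul_of_mem_span_mul hA (δ * γ) hju (hspan.ge hx) (hspan.ge hy)
  obtain ⟨ε, hε, hH, he⟩ := C.exists_generated_map_mul_of_span_eq hA (δ * γ) h.one_mem hmul e
    (S := {1, u, j, j * u}) (by simpa only [Finset.coe_insert, Finset.coe_singleton] using hspan)
  have hmul' (x : A) (hx : x ∈ H) (y : A) (hy : y ∈ H) :
      (ε * (δ * γ)) (x * y) = (ε * (δ * γ)) x * (ε * (δ * γ)) y := by
    rw [hH _ (mul_mem hx hy), hH x hx, hH y hy, hmul x hx y hy]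
  have hmem : ε * (δ * γ) ∈ C.generated := C.isotopyGroup_le_generated
    ⟨1, .of_map_mul (h.map_mul_of_map_mul hdim hA (ε * (δ * γ)) hmul' he)⟩
  rwa [Subgroup.mul_mem_cancel_left _ hε, Subgroup.mul_mem_cancel_left _ hδ] at hmem

end CompositionDivisionAlgebra.IsCayleyDicksonPair

theorem disjoint_zpowers_of_mul_self_eq_one {G : Type*} [Group G] {z : G} {N : Subgroup G}
    (hz : z * z = 1) (hzN : z ∉ N) : Disjoint (Subgroup.zpowers z) N := by
  rw [Subgroup.disjoint_def]
  rintro _ ⟨n, rfl⟩ hn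
  obtain ⟨m, rfl | rfl⟩ := Int.even_or_odd' n
  · simp only [zpow_mul, zpow_two, hz, one_zpow]
  · simp only [zpow_add, zpow_mul, zpow_two, hz, one_zpow, one_mul, zpow_one] at hn
    exact absurd hn hzN

theorem exists_zpowers_prod_mulEquiv_closure {G : Type*} [Group G] {z : G} {N : Subgroup G}
    (hz : z ∈ Subgroup.center G) (hdisj : Disjoint (Subgroup.zpowers z) N) :
    ∃ F : Subgroup.zpowers z × N ≃* Subgroup.closure ({z} ∪ (N : Set G)),
      ∀ (a : Subgroup.zpowers z) (g : N), (F (a, g) : G) = a * g := by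
  let f := (Subgroup.zpowers z).subtype.noncommCoprod N.subtype fun a g =>
    (Subgroup.mem_center_iff.1 (Subgroup.zpowers_le.2 hz a.2) g).symm
  have hf : Function.Injective f := (MonoidHom.noncommCoprod_injective _ _ _).2
    ⟨Subgroup.subtype_injective _, Subgroup.subtype_injective _, by
      simpa only [Subgroup.range_subtype] using hdisj⟩
  have hrange : f.range = Subgroup.closure ({z} ∪ (N : Set G)) :=
    (MonoidHom.noncommCoprod_range _ _ _).trans (by
      rw [Subgroup.range_subtype, Subgroup.range_subtype, Subgroup.closure_union,
        Subgroup.closure_eq, Subgroup.zpowers_eq_closure])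
  exact ⟨(MonoidHom.ofInjective hf).trans (MulEquiv.subgroupCongr hrange), fun _ _ => rfl⟩

namespace OctonionDivisionAlgebra

variable {K : Type u} {O : Type v} [Field K] [NonAssocRing O] [Module K O]
  {P : OctonionDivisionAlgebra K O}

namespace IsPsi

variable {H : NonUnitalSubalgebra K O} {e w : O} {ψ : O → O} (h : P.IsPsi H e w ψ)
include h

theorem isCayleyDicksonPair : P.composition.IsCayleyDicksonPair H e where
  one_mem := h.one_mem
  quaternion := h.quaternion
  ne_zero := h.e_ne_zero
  polar_eq_zero x hx := P.composition.smul_one_injective (by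
    simp only [← P.bilin_eq, h.e_orthogonal x hx, zero_smul])

theorem eq_psi : ψ = h.isCayleyDicksonPair.psi P.finrank_eq w := by
  obtain ⟨w', -, hww', -, hψ⟩ := h.apply_eq
  funext z
  obtain ⟨x, hx, y, hy, rfl⟩ := h.isCayleyDicksonPair.exists_eq_add_mul P.finrank_eq z
  rw [hψ x hx y hy, h.isCayleyDicksonPair.psi_apply _ w hx hy,
    CompositionDivisionAlgebra.conjugation_apply, P.composition.inv_eq_of_mul_eq_one hww']

end IsPsi

theorem isPsi_psi {H : NonUnitalSubalgebra K O} {e w : O}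
    (h : P.composition.IsCayleyDicksonPair H e) (hw : w ∈ H) (hw0 : w ≠ 0) :
    P.IsPsi H e w (h.psi P.finrank_eq w) where
  one_mem := h.one_mem
  quaternion := h.quaternion
  e_ne_zero := h.ne_zero
  e_orthogonal x hx := by rw [P.bilin_eq, h.polar_eq_zero x hx, zero_smul]
  w_mem := hw
  w_ne_zero := hw0
  apply_eq := ⟨P.composition.inv w, h.inv_mem hw, P.composition.mul_inv_cancel hw0,
    P.composition.inv_mul_cancel hw0, fun _ hx _ hy => h.psi_apply P.finrank_eq w hx hy⟩

variable (P)

theorem exists_isCayleyDicksonPair_mem (a : O) :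
    ∃ (H : NonUnitalSubalgebra K O) (e : O), P.composition.IsCayleyDicksonPair H e ∧ a ∈ H := by
  obtain ⟨H, one_mem, quaternion, ha⟩ := P.exists_quaternion_subalgebra_mem a
  obtain ⟨e, ne_zero, polar_eq_zero⟩ := P.composition.exists_orthogonal quaternion P.finrank_eq
  exact ⟨H, e, ⟨one_mem, quaternion, ne_zero, polar_eq_zero⟩, ha⟩

/-- The map `ψ_(H, e, a⁻¹)` is isotopic with respect to the same `a` as `γ`, so that composing its
inverse with `γ` gives a ring automorphism. -/
theorem coe_mem_Gamma {γ : jordanAut O} (hγ : γ ∈ P.composition.isotopyGroup) :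
    ⇑γ.1 ∈ P.Gamma := by
  obtain ⟨a, ha, hγ⟩ := hγ
  obtain ⟨H, e, h, haH⟩ := P.exists_isCayleyDicksonPair_mem a
  have hw := h.inv_mem haH
  have hw0 := P.composition.inv_ne_zero ha
  let δ := h.psiAut P.finrank_eq hw hw0
  have hiso : P.composition.IsIsotopic δ _ := h.isIsotopic_psi P.finrank_eq hw hw0
  rw [P.composition.inv_inv] at hiso
  have hδ (x : O) : δ ((δ⁻¹ * γ) x) = γ x := jordanAut.apply_inv_self δ _
  have hmul (x y : O) : (δ⁻¹ * γ) (x * y) = (δ⁻¹ * γ) x * (δ⁻¹ * γ) y := by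
    apply jordanAut.injective δ
    rw [hδ, hiso.2, hδ, hδ, hγ]
  exact ⟨_, ⟨H, e, _, isPsi_psi h hw hw0⟩,
    { (δ⁻¹ * γ).1 with map_add' := map_add (δ⁻¹ * γ), map_mul' := hmul },
    funext fun x => (hδ x).symm⟩

theorem image_isotopyGroup :
    (fun γ : jordanAut O => (⇑γ.1 : O → O)) '' (P.composition.isotopyGroup : Set (jordanAut O)) =
      P.Gamma := by
  refine Set.Subset.antisymm (Set.image_subset_iff.2 fun _ => P.coe_mem_Gamma) ?_
  rintro _ ⟨ψ, ⟨H, e, w, hψ⟩, φ, rfl⟩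
  have h := hψ.isCayleyDicksonPair
  let φJ : jordanAut O := ⟨φ.toEquiv, map_add φ, _root_.map_one φ, fun x y =>
    (_root_.map_mul φ _ _).trans (congrArg (· * φ x) (_root_.map_mul φ x y))⟩
  have hφJ : φJ ∈ P.composition.isotopyGroup := ⟨1, .of_map_mul (_root_.map_mul φ)⟩
  exact ⟨h.psiAut P.finrank_eq hψ.w_mem hψ.w_ne_zero * φJ,
    mul_mem ⟨_, h.isIsotopic_psi P.finrank_eq hψ.w_mem hψ.w_ne_zero⟩ hφJ,
    congrArg (· ∘ φ) hψ.eq_psi.symm⟩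

end OctonionDivisionAlgebra

theorem mainTheorem3 {K : Type u} {O : Type v} [Field K] [NonAssocRing O] [Module K O]
    (P : OctonionDivisionAlgebra K O) :
    ∃ (s : jordanAut O) (Γ : Subgroup (jordanAut O)),
      (∀ x : O, s.1 x = P.conj x) ∧
      (fun γ : jordanAut O => (⇑γ.1 : O → O)) '' (Γ : Set (jordanAut O)) = P.Gamma ∧
      s ∈ Subgroup.center (jordanAut O) ∧
      Subgroup.closure ({s} ∪ (Γ : Set (jordanAut O))) = ⊤ ∧
      ∃ F : Subgroup.zpowers s × Γ ≃* Subgroup.closure ({s} ∪ (Γ : Set (jordanAut O))),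
        ∀ (a : Subgroup.zpowers s) (g : Γ), (F (a, g) : jordanAut O) = a * g := by
  have hcomm := P.exists_not_commute
  have hcenter := P.composition.conjJordan_mem_center hcomm
  have hdisj := disjoint_zpowers_of_mul_self_eq_one P.composition.conjJordan_mul_self
    (P.composition.conjJordan_notMem_isotopyGroup hcomm)
  obtain ⟨H, e, h, -⟩ := P.exists_isCayleyDicksonPair_mem 1
  exact ⟨P.composition.conjJordan, P.composition.isotopyGroup, fun _ => rfl,
    P.image_isotopyGroup, hcenter, h.generated_eq_top P.finrank_eq hcomm,
    exists_zpowers_prod_mulEquiv_closure hcenter hdisj⟩
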